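/- Let $p$ be a prime, $F=\mathbb F_{p^m}$, $\alpha=p^m$, $n\ge 0$, and let $\omega\in\mathbb C$ be a primitive $p$-th root of unity. Let $\mathcal H=\mathbb C^{F}$, so that $\mathcal H^{\otimes n}$ has the orthonormal basis $|y\rangle$, $y\in F^n$. For $a,d\in F^n$ put $X^a=\sum_y|y+a\rangle\langle y|$ and $Z^d=\sum_y\omega^{\mathrm{tr}_{F/\mathbb F_p}(d^{t}y)}|y\rangle\langle y|$, and let $G$ be the group generated by all $X^aZ^d$. A *stabilizer code* of length $n$ over $F$ is a nonzero joint eigenspace in $\mathcal H^{\otimes n}$ of an abelian normal subgroup of $G$. Two codes of length $n$ over $F$ are *equivalent* if one is mapped onto the other by a permutation of the $n$ tensor factors followed by unitaries on the single factors, such that the resulting operator maps every $X^aZ^d$, by conjugation, to a scalar multiple of some $X^{a'}Z^{d'}$. Let $\chi$ be a non-degenerate symmetric bicharacter on the additive group of $F$, and let $\Gamma\in\mathbb Z^{(k+n)\times(k+n)}$ be symmetric with zero diagonal (the adjacency matrix of a weighted loopless graph). For $x\in F^k$ put $$|x\rangle=\frac1{\sqrt{\alpha^n}}\sum_{y\in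 F^n}\Bigl(\prod_{1\le i<j\le k+n}\chi(z_i,z_j)^{\Gamma_{ij}}\Bigr)|y\rangle,\qquad z=(x,y),$$ and let $Q_{\chi,\Gamma}$ be the span of these vectors. A *graphical quantum code* over $F$ is such a span $Q_{\chi,\Gamma}$ of dimension $\alpha^k$. Let $B\in\mathbb F_p^{k\times n}$ and $M_y\in\mathbb F_p^{n\times n}$ be the reductions modulo $p$ of the upper right and the lower right block of $\Gamma$. Fix a basis of $F$ over $\mathbb F_p$. Taking coordinates identifies $F^n$ with $\mathbb F_p^{nm}$, and hence $(\mathbb C^{F})^{\otimes n}$ with $(\mathbb C^{p})^{\otimes nm}$, so that every code of length $n$ over $F$ is also a code of length $nm$ over $\mathbb F_p$. 1. For every stabilizer code $Q$ of length $n$ over $F$ there is a code $Q'$ that, regarded as a code of length $nm$ over $\mathbb F_p$, is a graphical quantum code over $\mathbb F_p$ (for some number $k'$ of input vertices, so $\dim Q'=p^{k'}$), and such that $Q$ and $Q'$ are equivalent, both as codes of length $nm$ over $\mathbb F_p$ and as codes of length $n$ over $F$. 2. Conversely, let $\chi$ and $\Gamma$ be as above, for $F$ and some $k\ge0$. The vectors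 $|x\rangle$, $x\in F^k$, are orthonormal if and only if $B$ has rank $k$, if and only if $\dim Q_{\chi,\Gamma}=\alpha^k$. The space $Q_{\chi,\Gamma}$ is a stabilizer code over $F$; in particular every graphical quantum code over $F$ is a stabilizer code. Moreover, in the chosen coordinates $\chi(h,g)=\omega^{h^{t}Mg}$ for a symmetric matrix $M\in\mathbb F_p^{m\times m}$, and, with $B'=B\otimes M$, $M_y'=M_y\otimes M$ and $q(a)=\sum_{i<j}(M_y')_{ij}a_ia_j$, the set of all elements of the error group of $(\mathbb C^p)^{\otimes nm}$ that fix every vector of $Q_{\chi,\Gamma}$ is $$\{\omega^{q(a)}X^aZ^{aM_y'} : a\in\mathbb F_p^{nm},\ B'a=0\},$$ and $Q_{\chi,\Gamma}$ is exactly the space of vectors fixed by all these operators. (For $m=1$ and $\chi(h,g)=\omega^{hg}$ one has $B'=B$ and $M_y'=M_y$.) -/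

import Mathlib

open scoped Matrix Kronecker

noncomputable section

namespace QCode

/-! The space of `n` qudits over the alphabet `F` is `(ι → F) → ℂ` with `ι = Fin n`; the function
`Pi.single y 1` is the basis vector `|y⟩`, and operators are matrices indexed by `ι → F`. -/

section Errors

variable {p : ℕ} [Fact p.Prime] {F : Type*} [Field F] [Fintype F] [DecidableEq F]
  [Algebra (ZMod p) F] {ι : Type*} [Fintype ι] [DecidableEq ι]

/-- The shift operator `X^a = ∑ y, |y + a⟩⟨y|`. -/
def opX (a : ι → F) : Matrix (ι → F) (ι → F) ℂ :=
  Matrix.of fun u v => if u = v + a then 1 else 0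

/-- The phase operator `Z^d = ∑ y, ω^{tr ⟨d, y⟩} |y⟩⟨y|`, with `tr` the trace from `F` to the prime
field `ZMod p`. For `F = ZMod p` the trace is the identity. -/
def opZ (p : ℕ) [Fact p.Prime] [Algebra (ZMod p) F] (ω : ℂ) (d : ι → F) :
    Matrix (ι → F) (ι → F) ℂ :=
  Matrix.diagonal fun y => ω ^ (Algebra.trace (ZMod p) F (d ⬝ᵥ y)).val

/-- The error group `G`, generated by the error basis `{X^a Z^d}`. -/
def errorGroup (p : ℕ) [Fact p.Prime] (F : Type*) [Field F] [Fintype F] [DecidableEq F]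
    [Algebra (ZMod p) F] (ι : Type*) [Fintype ι] [DecidableEq ι] (ω : ℂ) :
    Subgroup (Matrix (ι → F) (ι → F) ℂ)ˣ :=
  Subgroup.closure {g | ∃ a d : ι → F, (g : Matrix (ι → F) (ι → F) ℂ) = opX a * opZ p ω d}

/-- A stabilizer code: a (nonzero) joint eigenspace of an abelian normal subgroup of the error
group; `ev g` is the eigenvalue of `g`. -/
def IsStabilizerCode (p : ℕ) [Fact p.Prime] [Algebra (ZMod p) F] (ω : ℂ)
    (Q : Submodule ℂ ((ι → F) → ℂ)) : Prop :=
  Q ≠ ⊥ ∧ ∃ S : Subgroup (errorGroup p F ι ω), S.Normal ∧ (∀ g ∈ S, ∀ h ∈ S, g * h = h * g) ∧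
    ∃ ev : errorGroup p F ι ω → ℂ, ∀ v, v ∈ Q ↔
      ∀ g ∈ S, ((g : (Matrix (ι → F) (ι → F) ℂ)ˣ) : Matrix (ι → F) (ι → F) ℂ) *ᵥ v = ev g • v

/-- The stabilizer of `Q`: the elements of the error group that fix every vector of `Q`. -/
def stabilizerOf (p : ℕ) [Fact p.Prime] [Algebra (ZMod p) F] (ω : ℂ)
    (Q : Submodule ℂ ((ι → F) → ℂ)) : Set (Matrix (ι → F) (ι → F) ℂ)ˣ :=
  {g | g ∈ errorGroup p F ι ω ∧ ∀ v ∈ Q, (g : Matrix (ι → F) (ι → F) ℂ) *ᵥ v = v}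

/-- The operator that permutes the tensor factors by `σ` and then applies `U i` to the `i`-th
factor. -/
def monomialOp (σ : Equiv.Perm ι) (U : ι → Matrix F F ℂ) : Matrix (ι → F) (ι → F) ℂ :=
  Matrix.of fun u v => ∏ i, U i (u i) (v (σ i))

/-- `T` maps the error basis to itself, up to scalars, by conjugation. -/
def PreservesErrors (p : ℕ) [Fact p.Prime] [Algebra (ZMod p) F] (ω : ℂ)
    (T : Matrix (ι → F) (ι → F) ℂ) : Prop :=
  ∀ a d : ι → F, ∃ (c : ℂ) (a' d' : ι → F),
    T * (opX a * opZ p ω d) = c • (opX a' * opZ p ω d') * T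

/-- Equivalence of codes over the alphabet `F`: a permutation of the tensor factors followed by
unitaries on the single factors, such that the whole operator preserves the error basis up to
scalars (so that it induces an isometry of the symplectic space that preserves the Hamming
weight), maps `Q` onto `Q'`. -/
def CodeEquivalent (p : ℕ) [Fact p.Prime] [Algebra (ZMod p) F] (ω : ℂ)
    (Q Q' : Submodule ℂ ((ι → F) → ℂ)) : Prop :=
  ∃ (σ : Equiv.Perm ι) (U : ι → Matrix F F ℂ), (∀ i, U i ∈ Matrix.unitaryGroup F ℂ) ∧
    PreservesErrors p ω (monomialOp σ U) ∧ Q' = Q.map (Matrix.mulVecLin (monomialOp σ U))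

end Errors

section Graph

variable {F : Type*} [Field F] [Fintype F] {k n : ℕ}

/-- A non-degenerate symmetric bicharacter on the additive group of `F`. -/
structure IsNondegSymmBicharacter (χ : F → F → Circle) : Prop where
  map_add : ∀ h g g', χ h (g + g') = χ h g * χ h g'
  symm : ∀ h g, χ h g = χ g h
  nondegenerate : ∀ h, (∀ g, χ h g = 1) → h = 0

/-- Adjacency matrix of a weighted undirected graph without loops, with integral weights. -/
structure IsWeightedAdjacency {N : ℕ} (Γ : Matrix (Fin N) (Fin N) ℤ) : Prop where
  symm : Γ.IsSymm
  loopless : ∀ i, Γ i i = 0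

/-- The vector `|x⟩ = |F|^{-n/2} ∑ y, (∏ i < j, χ(z_i, z_j)^{Γ_ij}) |y⟩`, where `z = (x, y)`. -/
def graphState (χ : F → F → Circle) (Γ : Matrix (Fin (k + n)) (Fin (k + n)) ℤ) (x : Fin k → F) :
    (Fin n → F) → ℂ := fun y =>
  ((Real.sqrt ((Fintype.card F : ℝ) ^ n))⁻¹ : ℂ) *
    ((∏ i : Fin (k + n), ∏ j ∈ Finset.Ioi i,
      χ (Fin.append x y i) (Fin.append x y j) ^ Γ i j : Circle) : ℂ)

/-- The span of the vectors `|x⟩`. -/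
def graphSpan (χ : F → F → Circle) (Γ : Matrix (Fin (k + n)) (Fin (k + n)) ℤ) :
    Submodule ℂ ((Fin n → F) → ℂ) :=
  Submodule.span ℂ (Set.range (graphState χ Γ))

/-- A graphical quantum code with `k` input vertices: a subspace of dimension `|F|^k` spanned by
the states of a weighted graph. -/
def IsGraphicalCode (k : ℕ) (Q : Submodule ℂ ((Fin n → F) → ℂ)) : Prop :=
  ∃ (χ : F → F → Circle) (Γ : Matrix (Fin (k + n)) (Fin (k + n)) ℤ),
    IsNondegSymmBicharacter χ ∧ IsWeightedAdjacency Γ ∧ Q = graphSpan χ Γ ∧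
      Module.finrank ℂ Q = Fintype.card F ^ k

/-- The `k × n` block of `Γ` between inputs and outputs, modulo `p`. -/
def blockB (p : ℕ) (Γ : Matrix (Fin (k + n)) (Fin (k + n)) ℤ) :
    Matrix (Fin k) (Fin n) (ZMod p) :=
  Matrix.of fun i j => (Γ (Fin.castAdd n i) (Fin.natAdd k j) : ZMod p)

/-- The `n × n` block of `Γ` on the outputs, modulo `p`. -/
def blockMy (p : ℕ) (Γ : Matrix (Fin (k + n)) (Fin (k + n)) ℤ) :
    Matrix (Fin n) (Fin n) (ZMod p) :=
  Matrix.of fun i j => (Γ (Fin.natAdd k i) (Fin.natAdd k j) : ZMod p)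

/-- The Kronecker product, with pairs of indices listed lexicographically. -/
def kron {R : Type*} [Mul R] {k n m : ℕ} (A : Matrix (Fin k) (Fin n) R)
    (M : Matrix (Fin m) (Fin m) R) : Matrix (Fin (k * m)) (Fin (n * m)) R :=
  Matrix.reindex finProdFinEquiv finProdFinEquiv (A ⊗ₖ M)

/-- The quadratic form `q(a) = ∑ i < j, C_ij a_i a_j`. -/
def quadForm {R : Type*} [CommSemiring R] {N : ℕ} (C : Matrix (Fin N) (Fin N) R) (a : Fin N → R) :
    R :=
  ∑ i, ∑ j ∈ Finset.Ioi i, C i j * a i * a j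

end Graph

section Coordinates

variable {p : ℕ} [Fact p.Prime] {F : Type*} [Field F] [Algebra (ZMod p) F] {m : ℕ}

/-- `F^n ≃ (ZMod p)^{nm}`: entry `i * m + j` is the `j`-th coordinate of `y i` in the basis `b`. -/
def coords (b : Module.Basis (Fin m) (ZMod p) F) (n : ℕ) :
    (Fin n → F) ≃ (Fin (n * m) → ZMod p) :=
  (Equiv.piCongrRight fun _ : Fin n => b.equivFun.toEquiv).trans
    ((Equiv.curry (Fin n) (Fin m) (ZMod p)).symm.trans
      (Equiv.arrowCongr finProdFinEquiv (Equiv.refl (ZMod p))))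

/-- The identification of `n` qudits of dimension `p^m` with `nm` qudits of dimension `p`, which
sends `|y⟩` to `|coords y⟩`. -/
def toPrime (b : Module.Basis (Fin m) (ZMod p) F) (n : ℕ) :
    ((Fin n → F) → ℂ) ≃ₗ[ℂ] ((Fin (n * m) → ZMod p) → ℂ) :=
  LinearEquiv.funCongrLeft ℂ ℂ (coords b n).symm

end Coordinates

end QCode

end

open scoped Matrix Kronecker

noncomputable section

namespace QCode

/-! A stabilizer code is determined by the errors that act on it as scalars: it is their joint
eigenspace (`ErrorClosed`), and every nonzero space with this property is a stabilizer code. In this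
form the notion passes between `F` and the prime field, because writing shifts in the given basis
and phases in the trace-dual basis turns errors into errors; it also survives local unitaries that
preserve errors.

For claim 1, work over the prime field. The pairs `(a, d)` whose error is scalar on the code form an
isotropic subspace (`errSpace`). Fourier matrices on an information set of its pure phase errors
make it meet `0 × (ZMod p)^N` trivially (`exists_locallyEquivalent_transversal`). Being isotropic,
it then lies in the graph of a symmetric matrix `C` (`exists_symm_matrix_of_isotropic`), whose
diagonal is cleared by quadratic phases on single qudits. The eigenvalues that remain form a
character of the space `W` of shifts, and a phase operator removes it. What is left is `graphCode ω
C W`, the graph phases times the `W`-invariant functions; writing `W` as the kernel of a matrix `B`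
with independent rows, Fourier expansion shows that graph states span it (`span_inputState`). Every
operation used acts on single prime qudits and permutes nothing, so it also acts on single qudits
over `F`, which gives both equivalences.

For claim 2, the bicharacter has a Gram matrix `M`, and a graph over `F` becomes in coordinates a
graph over the prime field with blocks `B ⊗ M` and `M_y ⊗ M`. Hence its span is again a `graphCode`.
Conjugating the shift by `a` with the graph phases gives `ω^{q(a)} X^a Z^{Ca}`
(`errOp_mulVec_graph`), and these operators are the stabilizer. Orthonormality is orthogonality of
the characters `y ↦ ω^{x B' y}`. -/

set_option linter.unusedSectionVars false

/-! ### Characters of the prime field and their orthogonality. -/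

section Phase

variable {p : ℕ} [Fact p.Prime] {ω : ℂ}

/-- The additive character `t ↦ ω ^ t` of `ZMod p`. -/
def phase (ω : ℂ) (t : ZMod p) : ℂ := ω ^ t.val

lemma phase_add (hω : IsPrimitiveRoot ω p) (s t : ZMod p) :
    phase ω (s + t) = phase ω s * phase ω t := by
  simp only [phase, ← AddChar.zmodChar_apply hω.pow_eq_one, AddChar.map_add_eq_mul]

@[simp] lemma phase_zero : phase ω (0 : ZMod p) = 1 := by simp [phase]

lemma phase_ne_zero (hω : IsPrimitiveRoot ω p) (t : ZMod p) : phase ω t ≠ 0 :=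
  pow_ne_zero _ (hω.ne_zero (NeZero.ne p))

lemma phase_neg (hω : IsPrimitiveRoot ω p) (t : ZMod p) : phase ω (-t) = (phase ω t)⁻¹ := by
  refine eq_inv_of_mul_eq_one_left ?_
  rw [← phase_add hω, neg_add_cancel, phase_zero]

lemma phase_sub (hω : IsPrimitiveRoot ω p) (s t : ZMod p) :
    phase ω (s - t) = phase ω s / phase ω t := by
  rw [sub_eq_add_neg, phase_add hω, phase_neg hω, div_eq_mul_inv]

lemma phase_sum (hω : IsPrimitiveRoot ω p) {ι : Type*} (s : Finset ι) (f : ι → ZMod p) :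
    phase ω (∑ i ∈ s, f i) = ∏ i ∈ s, phase ω (f i) := by
  classical
  induction s using Finset.induction_on with
  | empty => simp
  | insert a s ha ih => rw [Finset.sum_insert ha, Finset.prod_insert ha, phase_add hω, ih]

lemma phase_injective (hω : IsPrimitiveRoot ω p) :
    Function.Injective (phase ω : ZMod p → ℂ) := fun s t h =>
  ZMod.val_injective p (hω.pow_inj s.val_lt t.val_lt h)

lemma phase_eq_one_iff (hω : IsPrimitiveRoot ω p) {t : ZMod p} : phase ω t = 1 ↔ t = 0 := by
  rw [← phase_zero (p := p) (ω := ω), (phase_injective hω).eq_iff]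

lemma exists_phase_eq (hω : IsPrimitiveRoot ω p) {z : ℂ} (hz : z ^ p = 1) :
    ∃ t : ZMod p, z = phase ω t := by
  obtain ⟨i, hi, h⟩ := hω.eq_pow_of_pow_eq_one hz
  exact ⟨(i : ZMod p), by rw [phase, ZMod.val_cast_of_lt hi, h]⟩

lemma norm_phase (hω : IsPrimitiveRoot ω p) (t : ZMod p) : ‖phase ω t‖ = 1 := by
  rw [phase, norm_pow, hω.norm'_eq_one (NeZero.ne p), one_pow]

lemma star_phase (hω : IsPrimitiveRoot ω p) (t : ZMod p) : star (phase ω t) = phase ω (-t) := by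
  rw [phase_neg hω, Complex.inv_eq_conj (norm_phase hω t)]; rfl

lemma sum_phase_mul (hω : IsPrimitiveRoot ω p) (x : ZMod p) :
    ∑ y : ZMod p, phase ω (x * y) = if x = 0 then (p : ℂ) else 0 := by
  split_ifs with h
  · simp [h, ZMod.card]
  · have h1 : ∑ y : ZMod p, phase ω (x * y) = phase ω x * ∑ y : ZMod p, phase ω (x * y) := by
      refine (Fintype.sum_equiv (Equiv.addLeft (1 : ZMod p)) (fun y => phase ω (x * (1 + y)))
        (fun y => phase ω (x * y)) fun _ => rfl).symm.trans ?_
      simp [mul_add, phase_add hω, Finset.mul_sum]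
    have h2 : phase ω x ≠ 1 := fun h' => h ((phase_eq_one_iff hω).1 h')
    by_contra h3
    exact h2 (mul_right_cancel₀ h3 (by rw [← h1, one_mul]))

lemma sum_phase_dotProduct (hω : IsPrimitiveRoot ω p) {κ : Type*} [Fintype κ] [DecidableEq κ]
    (x : κ → ZMod p) :
    ∑ y : κ → ZMod p, phase ω (x ⬝ᵥ y) = if x = 0 then (p : ℂ) ^ Fintype.card κ else 0 := by
  have h : ∑ y : κ → ZMod p, phase ω (x ⬝ᵥ y) = ∏ i, ∑ t : ZMod p, phase ω (x i * t) := by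
    rw [Finset.prod_univ_sum, Fintype.piFinset_univ]
    simp only [dotProduct, phase_sum hω]
  rw [h]
  simp only [sum_phase_mul hω]
  split_ifs with hx
  · simp [hx]
  · obtain ⟨i, hi⟩ := Function.ne_iff.1 hx
    exact Finset.prod_eq_zero (Finset.mem_univ i) (if_neg hi)

end Phase

/-! ### The trace pairing. -/

section TracePairing

variable {p : ℕ} [Fact p.Prime] {F : Type*} [Field F] [Algebra (ZMod p) F] {ι : Type*} [Fintype ι]

/-- The trace pairing on `F^ι`, with values in the prime field. -/
def trDot (p : ℕ) [Fact p.Prime] [Algebra (ZMod p) F] (d y : ι → F) : ZMod p :=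
  Algebra.trace (ZMod p) F (d ⬝ᵥ y)

lemma trDot_add_left (d d' y : ι → F) : trDot p (d + d') y = trDot p d y + trDot p d' y := by
  simp [trDot, add_dotProduct]

lemma trDot_add_right (d y y' : ι → F) : trDot p d (y + y') = trDot p d y + trDot p d y' := by
  simp [trDot, dotProduct_add]

lemma trDot_sub_right (d y y' : ι → F) : trDot p d (y - y') = trDot p d y - trDot p d y' := by
  simp [trDot, dotProduct_sub]

lemma trDot_neg_right (d y : ι → F) : trDot p d (-y) = -trDot p d y := by
  simp [trDot, dotProduct_neg]

lemma trDot_zmod (d y : ι → ZMod p) : trDot p d y = d ⬝ᵥ y := Algebra.trace_self_apply _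

end TracePairing

/-! ### The error group, and stabilizer codes as error-closed spaces. -/

section ErrorOps

variable {p : ℕ} [Fact p.Prime] {F : Type*} [Field F] [Fintype F] [DecidableEq F]
  [Algebra (ZMod p) F] {ι : Type*} [Fintype ι] [DecidableEq ι] {ω : ℂ}

lemma mulVec_ext {κ : Type*} [Fintype κ] [DecidableEq κ] {A B : Matrix κ κ ℂ}
    (h : ∀ v, A *ᵥ v = B *ᵥ v) : A = B :=
  Matrix.mulVec_injective (funext h)

/-- The element `X^a Z^d` of the error basis. -/
def errOp (p : ℕ) [Fact p.Prime] [Algebra (ZMod p) F] (ω : ℂ) (a d : ι → F) :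
    Matrix (ι → F) (ι → F) ℂ := opX a * opZ p ω d

lemma errOp_apply (a d u v : ι → F) :
    errOp p ω a d u v = if u = v + a then phase ω (trDot p d v) else 0 := by
  simp [errOp, opX, opZ, phase, trDot, Matrix.mul_diagonal]

lemma errOp_mulVec (a d : ι → F) (v : (ι → F) → ℂ) (y : ι → F) :
    (errOp p ω a d *ᵥ v) y = phase ω (trDot p d (y - a)) * v (y - a) := by
  simp only [Matrix.mulVec, dotProduct, errOp_apply]
  rw [Finset.sum_eq_single (y - a)]
  · simp
  · intro b _ hb
    rw [if_neg, zero_mul]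
    rintro rfl
    simp at hb
  · simp

lemma errOp_zero : errOp p ω (0 : ι → F) 0 = 1 := by
  refine mulVec_ext fun v => funext fun y => ?_
  rw [errOp_mulVec]
  simp [trDot]

lemma errOp_mul (hω : IsPrimitiveRoot ω p) (a d a' d' : ι → F) :
    errOp p ω a d * errOp p ω a' d' =
      phase ω (trDot p d a') • errOp p ω (a + a') (d + d') := by
  refine mulVec_ext fun v => funext fun y => ?_
  rw [← Matrix.mulVec_mulVec, Matrix.smul_mulVec, Pi.smul_apply, errOp_mulVec, errOp_mulVec,
    errOp_mulVec, smul_eq_mul, ← mul_assoc, ← mul_assoc, ← phase_add hω, ← phase_add hω, sub_sub]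
  congr 2
  simp only [trDot_add_left, trDot_sub_right, trDot_add_right]
  ring

lemma errOp_comm (hω : IsPrimitiveRoot ω p) (a d a' d' : ι → F) :
    errOp p ω a d * errOp p ω a' d' =
      phase ω (trDot p d a' - trDot p d' a) • (errOp p ω a' d' * errOp p ω a d) := by
  rw [errOp_mul hω, errOp_mul hω, smul_smul, ← phase_add hω, add_comm a', add_comm d']
  congr 2
  ring

lemma errOp_mul_inv (hω : IsPrimitiveRoot ω p) (a d : ι → F) :
    errOp p ω a d * (phase ω (trDot p d a) • errOp p ω (-a) (-d)) = 1 := by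
  rw [Matrix.mul_smul, errOp_mul hω, smul_smul, ← phase_add hω, add_neg_cancel, add_neg_cancel,
    errOp_zero, trDot_neg_right, add_neg_cancel, phase_zero, one_smul]

/-- `X^a Z^d` as an invertible matrix. -/
def errUnit (hω : IsPrimitiveRoot ω p) (a d : ι → F) : (Matrix (ι → F) (ι → F) ℂ)ˣ where
  val := errOp p ω a d
  inv := phase ω (trDot p d a) • errOp p ω (-a) (-d)
  val_inv := errOp_mul_inv hω a d
  inv_val := mul_eq_one_comm.1 (errOp_mul_inv hω a d)

lemma errUnit_mem (hω : IsPrimitiveRoot ω p) (a d : ι → F) :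
    errUnit hω a d ∈ errorGroup p F ι ω :=
  Subgroup.subset_closure ⟨a, d, rfl⟩

/-- Reordering a product of errors costs only powers of `ω`, so no other scalars enter the group. -/
lemma exists_eq_phase_smul_errOp (hω : IsPrimitiveRoot ω p) {g : (Matrix (ι → F) (ι → F) ℂ)ˣ}
    (hg : g ∈ errorGroup p F ι ω) :
    ∃ (t : ZMod p) (a d : ι → F), (g : Matrix (ι → F) (ι → F) ℂ) = phase ω t • errOp p ω a d := by
  induction hg using Subgroup.closure_induction with
  | mem g hg =>
    obtain ⟨a, d, h⟩ := hg
    exact ⟨0, a, d, by rw [h, phase_zero, one_smul, errOp]⟩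
  | one => exact ⟨0, 0, 0, by rw [errOp_zero, phase_zero, one_smul, Units.val_one]⟩
  | mul g h _ _ hg hh =>
    obtain ⟨t, a, d, hg⟩ := hg
    obtain ⟨s, a', d', hh⟩ := hh
    refine ⟨t + s + trDot p d a', a + a', d + d', ?_⟩
    rw [Units.val_mul, hg, hh, Matrix.smul_mul, Matrix.mul_smul, errOp_mul hω, smul_smul, smul_smul,
      phase_add hω, phase_add hω, mul_assoc]
  | inv g _ hg =>
    obtain ⟨t, a, d, hg⟩ := hg
    refine ⟨-t + trDot p d a, -a, -d, ?_⟩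
    rw [Units.inv_eq_of_mul_eq_one_right]
    rw [hg, phase_add hω, mul_smul, Matrix.smul_mul, Matrix.mul_smul, errOp_mul_inv hω, smul_smul,
      ← phase_add hω, add_neg_cancel, phase_zero, one_smul]

/-- `Q` is the joint eigenspace of all errors that act on it as scalars. -/
def ErrorClosed (p : ℕ) [Fact p.Prime] [Algebra (ZMod p) F] (ω : ℂ)
    (Q : Submodule ℂ ((ι → F) → ℂ)) : Prop :=
  ∀ v, (∀ (a d : ι → F) (c : ℂ), (∀ w ∈ Q, errOp p ω a d *ᵥ w = c • w) →
    errOp p ω a d *ᵥ v = c • v) → v ∈ Q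

lemma IsStabilizerCode.errorClosed (hω : IsPrimitiveRoot ω p) {Q : Submodule ℂ ((ι → F) → ℂ)}
    (h : IsStabilizerCode p ω Q) : ErrorClosed p ω Q := by
  obtain ⟨-, S, -, -, ev, hS⟩ := h
  intro v hv
  rw [hS]
  intro g hg
  obtain ⟨t, a, d, h⟩ := exists_eq_phase_smul_errOp hω g.2
  have key : ∀ w, ((g : (Matrix (ι → F) (ι → F) ℂ)ˣ) : Matrix (ι → F) (ι → F) ℂ) *ᵥ w = ev g • w ↔
      errOp p ω a d *ᵥ w = ((phase ω t)⁻¹ * ev g) • w := by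
    intro w
    rw [h, Matrix.smul_mulVec, mul_smul, eq_inv_smul_iff₀ (phase_ne_zero hω t)]
  rw [key]
  exact hv a d _ fun w hw => (key w).1 ((hS w).1 hw g hg)

/-- The subgroup is that of all group elements acting as scalars on `Q`. It is normal because two
errors commute up to a scalar, and abelian because on a nonzero vector of `Q` that scalar must be
`1`. -/
lemma ErrorClosed.isStabilizerCode (hω : IsPrimitiveRoot ω p) {Q : Submodule ℂ ((ι → F) → ℂ)}
    (h : ErrorClosed p ω Q) (hQ : Q ≠ ⊥) : IsStabilizerCode p ω Q := by
  classical
  obtain ⟨v₀, hv₀, hne⟩ := Q.ne_bot_iff.1 hQ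
  let S : Subgroup (errorGroup p F ι ω) :=
    { carrier := {g | ∃ c : ℂ, ∀ w ∈ Q, ((g : (Matrix (ι → F) (ι → F) ℂ)ˣ) :
        Matrix (ι → F) (ι → F) ℂ) *ᵥ w = c • w}
      one_mem' := ⟨1, fun w _ => by simp⟩
      mul_mem' := by
        rintro g h ⟨c, hc⟩ ⟨c', hc'⟩
        refine ⟨c' * c, fun w hw => ?_⟩
        rw [Subgroup.coe_mul, Units.val_mul, ← Matrix.mulVec_mulVec, hc' w hw, Matrix.mulVec_smul,
          hc w hw, smul_smul]
      inv_mem' := by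
        rintro g ⟨c, hc⟩
        have hinv : ∀ w, (((g⁻¹ : errorGroup p F ι ω) : (Matrix (ι → F) (ι → F) ℂ)ˣ) :
            Matrix (ι → F) (ι → F) ℂ) *ᵥ (((g : (Matrix (ι → F) (ι → F) ℂ)ˣ) :
            Matrix (ι → F) (ι → F) ℂ) *ᵥ w) = w := by
          intro w
          rw [Matrix.mulVec_mulVec, ← Units.val_mul, ← Subgroup.coe_mul, inv_mul_cancel]
          simp
        have hc0 : c ≠ 0 := by
          rintro rfl
          apply hne
          rw [← hinv v₀, hc v₀ hv₀]
          simp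
        refine ⟨c⁻¹, fun w hw => ?_⟩
        rw [eq_inv_smul_iff₀ hc0, ← Matrix.mulVec_smul, ← hc w hw, hinv] }
  have scal : ∀ g h : errorGroup p F ι ω, ∃ s : ℂ,
      ((g * h : errorGroup p F ι ω) : (Matrix (ι → F) (ι → F) ℂ)ˣ).val =
        s • ((h * g : errorGroup p F ι ω) : (Matrix (ι → F) (ι → F) ℂ)ˣ).val := by
    intro g h
    obtain ⟨t, a, d, hg⟩ := exists_eq_phase_smul_errOp hω g.2
    obtain ⟨t', a', d', hh⟩ := exists_eq_phase_smul_errOp hω h.2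
    refine ⟨phase ω (trDot p d a' - trDot p d' a), ?_⟩
    rw [Subgroup.coe_mul, Subgroup.coe_mul, Units.val_mul, Units.val_mul, hg, hh, Matrix.smul_mul,
      Matrix.mul_smul, errOp_comm hω, Matrix.smul_mul, Matrix.mul_smul]
    simp only [smul_smul]
    congr 1
    ring
  -- The eigenvalue is the scalar by which `g` acts; the value `0` outside `S` plays no role.
  refine ⟨hQ, S, ⟨?_⟩, ?_, fun g => if hg : g ∈ S then hg.choose else 0, fun v => ⟨?_, ?_⟩⟩
  · rintro g ⟨c, hc⟩ h
    obtain ⟨s, hs⟩ := scal (h * g) h⁻¹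
    refine ⟨s * c, fun w hw => ?_⟩
    rw [hs, Matrix.smul_mulVec, inv_mul_cancel_left, hc w hw, smul_smul]
  · rintro g ⟨c, hc⟩ h ⟨c', hc'⟩
    obtain ⟨s, hs⟩ := scal g h
    have h1 : ∀ g h : errorGroup p F ι ω, ∀ c c' : ℂ,
        (∀ w ∈ Q, ((g : (Matrix (ι → F) (ι → F) ℂ)ˣ) : Matrix (ι → F) (ι → F) ℂ) *ᵥ w = c • w) →
        (∀ w ∈ Q, ((h : (Matrix (ι → F) (ι → F) ℂ)ˣ) : Matrix (ι → F) (ι → F) ℂ) *ᵥ w = c' • w) →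
        ((g * h : errorGroup p F ι ω) : (Matrix (ι → F) (ι → F) ℂ)ˣ).val *ᵥ v₀ = (c * c') • v₀ := by
      intro g h c c' hc hc'
      rw [Subgroup.coe_mul, Units.val_mul, ← Matrix.mulVec_mulVec, hc' _ hv₀, Matrix.mulVec_smul,
        hc _ hv₀, smul_smul, mul_comm]
    have h2 := h1 g h c c' hc hc'
    have h3 := h1 h g c' c hc' hc
    have h4 : ((h * g : errorGroup p F ι ω) : (Matrix (ι → F) (ι → F) ℂ)ˣ).val *ᵥ v₀ ≠ 0 := by
      intro h0
      apply hne
      have := congrArg (fun u => (((h * g : errorGroup p F ι ω) :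
        (Matrix (ι → F) (ι → F) ℂ)ˣ)⁻¹).val *ᵥ u) h0
      simpa only [Matrix.mulVec_mulVec, Units.inv_mul, Matrix.one_mulVec, Matrix.mulVec_zero]
        using this
    have h5 : s = 1 := by
      rw [hs, Matrix.smul_mulVec, mul_comm, ← h3] at h2
      exact smul_left_injective ℂ h4 (by simpa using h2)
    apply Subtype.ext
    apply Units.ext
    rw [hs, h5, one_smul]
  · intro hv g hg
    simp only [dif_pos hg]
    exact hg.choose_spec v hv
  · intro hv
    refine h v fun a d c hc => ?_
    have hg : (⟨errUnit hω a d, errUnit_mem hω a d⟩ : errorGroup p F ι ω) ∈ S := ⟨c, hc⟩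
    have h1 := hv _ hg
    simp only [dif_pos hg] at h1
    have h2 : hg.choose = c := by
      refine smul_left_injective ℂ hne ?_
      change hg.choose • v₀ = c • v₀
      rw [← hg.choose_spec v₀ hv₀]
      exact hc v₀ hv₀
    rw [h2] at h1
    exact h1

end ErrorOps

/-! ### Local operators and permutation-free equivalence. -/

section Local

variable {p : ℕ} [Fact p.Prime] {F : Type*} [Field F] [Fintype F] [DecidableEq F]
  [Algebra (ZMod p) F] {ι : Type*} [Fintype ι] [DecidableEq ι] {ω : ℂ}

lemma monomialOp_one_mul (U V : ι → Matrix F F ℂ) :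
    monomialOp 1 U * monomialOp 1 V = monomialOp 1 fun i => U i * V i := by
  ext u v
  simp only [Matrix.mul_apply, monomialOp, Matrix.of_apply, Equiv.Perm.coe_one, id]
  rw [Finset.prod_univ_sum, Fintype.piFinset_univ]
  simp only [Finset.prod_mul_distrib]

lemma monomialOp_one_one : monomialOp 1 (fun _ : ι => (1 : Matrix F F ℂ)) = 1 := by
  ext u v
  simp only [monomialOp, Matrix.of_apply, Equiv.Perm.coe_one, id, Matrix.one_apply]
  split_ifs with h
  · simp [h]
  · obtain ⟨i, hi⟩ := Function.ne_iff.1 h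
    exact Finset.prod_eq_zero (Finset.mem_univ i) (if_neg hi)

/-- The inverse of a local unitary operator. -/
lemma monomialOp_star_mul {U : ι → Matrix F F ℂ} (hU : ∀ i, U i ∈ Matrix.unitaryGroup F ℂ) :
    (monomialOp 1 fun i => star (U i)) * monomialOp 1 U = 1 := by
  rw [monomialOp_one_mul]
  simp only [fun i => Unitary.star_mul_self_of_mem (hU i)]
  exact monomialOp_one_one

/-- Equivalence by unitaries on the single factors, without a permutation. -/
def LocallyEquivalent (p : ℕ) [Fact p.Prime] [Algebra (ZMod p) F] (ω : ℂ)
    (Q Q' : Submodule ℂ ((ι → F) → ℂ)) : Prop :=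
  ∃ U : ι → Matrix F F ℂ, (∀ i, U i ∈ Matrix.unitaryGroup F ℂ) ∧
    PreservesErrors p ω (monomialOp 1 U) ∧ Q' = Q.map (Matrix.mulVecLin (monomialOp 1 U))

lemma LocallyEquivalent.codeEquivalent {Q Q' : Submodule ℂ ((ι → F) → ℂ)}
    (h : LocallyEquivalent p ω Q Q') : CodeEquivalent p ω Q Q' := by
  obtain ⟨U, h⟩ := h
  exact ⟨1, U, h⟩

lemma LocallyEquivalent.trans {Q Q' Q'' : Submodule ℂ ((ι → F) → ℂ)}
    (h : LocallyEquivalent p ω Q Q') (h' : LocallyEquivalent p ω Q' Q'') :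
    LocallyEquivalent p ω Q Q'' := by
  obtain ⟨U, hU, hP, rfl⟩ := h
  obtain ⟨V, hV, hP', rfl⟩ := h'
  refine ⟨fun i => V i * U i, fun i => mul_mem (hV i) (hU i), ?_, ?_⟩
  · intro a d
    obtain ⟨c, a', d', h⟩ := hP a d
    obtain ⟨c', a'', d'', h'⟩ := hP' a' d'
    refine ⟨c * c', a'', d'', ?_⟩
    rw [← monomialOp_one_mul, Matrix.mul_assoc, h, Matrix.smul_mul, Matrix.mul_smul,
      ← Matrix.mul_assoc, h', Matrix.smul_mul, Matrix.smul_mul, Matrix.smul_mul, smul_smul,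
      Matrix.mul_assoc]
  · rw [← Submodule.map_comp, ← Matrix.mulVecLin_mul, monomialOp_one_mul]

lemma LocallyEquivalent.ne_bot {Q Q' : Submodule ℂ ((ι → F) → ℂ)}
    (h : LocallyEquivalent p ω Q Q') (hQ : Q ≠ ⊥) : Q' ≠ ⊥ := by
  obtain ⟨U, hU, -, rfl⟩ := h
  obtain ⟨v, hv, hne⟩ := Q.ne_bot_iff.1 hQ
  refine (Submodule.ne_bot_iff _).2 ⟨_, Submodule.mem_map_of_mem hv, fun h0 => hne ?_⟩
  rw [← Matrix.one_mulVec v, ← monomialOp_star_mul hU, ← Matrix.mulVec_mulVec]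
  rw [Matrix.mulVecLin_apply] at h0
  rw [h0, Matrix.mulVec_zero]

lemma LocallyEquivalent.errorClosed (hω : IsPrimitiveRoot ω p) {Q Q' : Submodule ℂ ((ι → F) → ℂ)}
    (h : LocallyEquivalent p ω Q Q') (hQ : ErrorClosed p ω Q) : ErrorClosed p ω Q' := by
  obtain ⟨U, hU, hP, rfl⟩ := h
  set T := monomialOp 1 U with hT
  set T' := monomialOp 1 fun i => star (U i) with hT'
  have h1 : T' * T = 1 := monomialOp_star_mul hU
  have h2 : T * T' = 1 := mul_eq_one_comm.1 h1
  intro v hv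
  refine ⟨T' *ᵥ v, hQ _ fun a d c hc => ?_, by
    rw [Matrix.mulVecLin_apply, Matrix.mulVec_mulVec, h2, Matrix.one_mulVec]⟩
  obtain ⟨s, a', d', hs⟩ := hP a d
  change T * errOp p ω a d = s • errOp p ω a' d' * T at hs
  -- The definition of `PreservesErrors` allows the scalar `0`; invertibility of `T` and of the
  -- error excludes it.
  have hs0 : s ≠ 0 := by
    rintro rfl
    rw [zero_smul, Matrix.zero_mul] at hs
    have h3 := congrArg (fun A => T' * A * (phase ω (trDot p d a) • errOp p ω (-a) (-d))) hs
    simp only [← Matrix.mul_assoc, h1, Matrix.one_mul, Matrix.mul_zero, Matrix.zero_mul,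
      errOp_mul_inv hω] at h3
    exact one_ne_zero h3
  have key := hv a' d' (s⁻¹ * c) (by
    rintro _ ⟨w, hw, rfl⟩
    have h4 : (s • errOp p ω a' d' * T) *ᵥ w = c • T *ᵥ w := by
      rw [← hs, ← Matrix.mulVec_mulVec, hc w hw, Matrix.mulVec_smul]
    rw [Matrix.smul_mul, Matrix.smul_mulVec, ← Matrix.mulVec_mulVec] at h4
    rw [Matrix.mulVecLin_apply, mul_smul, eq_inv_smul_iff₀ hs0, h4])
  have h5 : errOp p ω a d = T' * (s • errOp p ω a' d' * T) := by
    rw [← hs, ← Matrix.mul_assoc, h1, Matrix.one_mul]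
  rw [h5, Matrix.mulVec_mulVec, Matrix.mul_assoc, Matrix.mul_assoc, h2, Matrix.mul_one,
    ← Matrix.mulVec_mulVec, Matrix.smul_mulVec, key, smul_smul, mul_inv_cancel_left₀ hs0,
    Matrix.mulVec_smul]

/-- `X^a Z^d` on a single factor. -/
def locErr (p : ℕ) [Fact p.Prime] [Algebra (ZMod p) F] (ω : ℂ) (a d : F) : Matrix F F ℂ :=
  Matrix.of fun u v => if u = v + a then phase ω (Algebra.trace (ZMod p) F (d * v)) else 0

lemma errOp_eq_monomialOp (hω : IsPrimitiveRoot ω p) (a d : ι → F) :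
    errOp p ω a d = monomialOp 1 fun i => locErr p ω (a i) (d i) := by
  ext u v
  rw [errOp_apply]
  simp only [monomialOp, locErr, Matrix.of_apply, Equiv.Perm.coe_one, id]
  split_ifs with h
  · subst h
    simp [trDot, dotProduct, phase_sum hω]
  · obtain ⟨i, hi⟩ := Function.ne_iff.1 h
    exact (Finset.prod_eq_zero (Finset.mem_univ i) (if_neg hi)).symm

lemma monomialOp_smul (c : ι → ℂ) (U : ι → Matrix F F ℂ) :
    (monomialOp 1 fun i => c i • U i) = (∏ i, c i) • monomialOp 1 U := by
  ext u v
  simp [monomialOp, Finset.prod_mul_distrib]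

/-- Relations on the single factors determine how a local operator acts on errors. -/
lemma monomialOp_mul_errOp (hω : IsPrimitiveRoot ω p) {U : ι → Matrix F F ℂ} {a d a' d' : ι → F}
    {c : ι → ℂ} (h : ∀ i, U i * locErr p ω (a i) (d i) =
      c i • (locErr p ω (a' i) (d' i) * U i)) :
    monomialOp 1 U * errOp p ω a d = (∏ i, c i) • errOp p ω a' d' * monomialOp 1 U := by
  rw [errOp_eq_monomialOp hω, errOp_eq_monomialOp hω, monomialOp_one_mul, Matrix.smul_mul,
    monomialOp_one_mul, ← monomialOp_smul]
  simp only [h]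

end Local

/-! ### Passage from `F` to the prime field. -/

section Transfer

variable {p : ℕ} [Fact p.Prime] {F : Type*} [Field F] [Algebra (ZMod p) F] {m : ℕ}

lemma coords_apply (b : Module.Basis (Fin m) (ZMod p) F) (n : ℕ) (y : Fin n → F)
    (i : Fin n) (j : Fin m) :
    coords b n y (finProdFinEquiv (i, j)) = b.equivFun (y i) j := by
  simp [coords, Equiv.arrowCongr]

lemma coords_add (b : Module.Basis (Fin m) (ZMod p) F) (n : ℕ) (y z : Fin n → F) :
    coords b n (y + z) = coords b n y + coords b n z := by
  ext l
  obtain ⟨⟨i, j⟩, rfl⟩ := finProdFinEquiv.surjective l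
  simp [coords_apply]

/-- Coordinates with respect to the trace-dual basis. -/
def trCoords (b : Module.Basis (Fin m) (ZMod p) F) (n : ℕ) (d : Fin n → F) :
    Fin (n * m) → ZMod p := fun l =>
  Algebra.trace (ZMod p) F (d (finProdFinEquiv.symm l).1 * b (finProdFinEquiv.symm l).2)

/-- Dual coordinates on the phase side turn the trace pairing into the standard dot product, so
`Z^d` over `F` becomes a phase operator over the prime field. -/
lemma trDot_eq (b : Module.Basis (Fin m) (ZMod p) F) (n : ℕ) (d y : Fin n → F) :
    trDot p d y = trCoords b n d ⬝ᵥ coords b n y := by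
  rw [dotProduct, ← finProdFinEquiv.sum_comp, Fintype.sum_prod_type]
  simp only [trCoords, Equiv.symm_apply_apply, coords_apply]
  rw [trDot, dotProduct, map_sum]
  refine Finset.sum_congr rfl fun i _ => ?_
  conv_lhs => rw [← b.sum_equivFun (y i), Finset.mul_sum, map_sum]
  refine Finset.sum_congr rfl fun j _ => ?_
  rw [mul_smul_comm, map_smul, smul_eq_mul, mul_comm]

/-- The trace form is nondegenerate, so `b` has a dual basis. Surjectivity ensures that every error
over the prime field comes from one over `F`. -/
lemma trCoords_surjective [Fintype F] (b : Module.Basis (Fin m) (ZMod p) F) (n : ℕ) :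
    Function.Surjective (trCoords b n) := by
  intro e
  have : Module.Finite (ZMod p) F := b.finiteDimensional_of_finite
  have hnd := traceForm_nondegenerate (ZMod p) F
  let b' := (Algebra.traceForm (ZMod p) F).dualBasis hnd b
  refine ⟨fun i => ∑ j, e (finProdFinEquiv (i, j)) • b' j, ?_⟩
  ext l
  obtain ⟨⟨i, j⟩, rfl⟩ := finProdFinEquiv.surjective l
  simp only [trCoords, Equiv.symm_apply_apply, Finset.sum_mul, map_sum, smul_mul_assoc, map_smul]
  have h : ∀ k, Algebra.trace (ZMod p) F (b' k * b j) = if j = k then 1 else 0 := fun k =>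
    LinearMap.BilinForm.apply_dualBasis_left hnd b k j
  simp [h]

variable [Fintype F] [DecidableEq F] {ω : ℂ}

lemma errOp_eq_submatrix (b : Module.Basis (Fin m) (ZMod p) F) (n : ℕ) (a d : Fin n → F) :
    errOp p ω a d =
      (errOp p ω (coords b n a) (trCoords b n d)).submatrix (coords b n) (coords b n) := by
  ext u v
  rw [Matrix.submatrix_apply, errOp_apply, errOp_apply, trDot_eq b, trDot_zmod, ← coords_add]
  simp only [(coords b n).injective.eq_iff]

lemma toPrime_submatrix_mulVec (b : Module.Basis (Fin m) (ZMod p) F) (n : ℕ)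
    (A : Matrix (Fin (n * m) → ZMod p) (Fin (n * m) → ZMod p) ℂ) (v : (Fin n → F) → ℂ) :
    toPrime b n (A.submatrix (coords b n) (coords b n) *ᵥ v) = A *ᵥ toPrime b n v := by
  rw [Matrix.submatrix_mulVec_equiv]
  ext u
  simp only [toPrime, LinearEquiv.funCongrLeft_apply, LinearMap.funLeft_apply, Function.comp,
    Equiv.apply_symm_apply]
  rfl

lemma toPrime_errOp_mulVec (b : Module.Basis (Fin m) (ZMod p) F) (n : ℕ) (a d : Fin n → F)
    (v : (Fin n → F) → ℂ) :
    toPrime b n (errOp p ω a d *ᵥ v) =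
      errOp p ω (coords b n a) (trCoords b n d) *ᵥ toPrime b n v := by
  rw [errOp_eq_submatrix b, toPrime_submatrix_mulVec]

lemma toPrime_errOp_eq_iff (b : Module.Basis (Fin m) (ZMod p) F) (n : ℕ) (a d : Fin n → F) (c : ℂ)
    (v : (Fin n → F) → ℂ) :
    errOp p ω (coords b n a) (trCoords b n d) *ᵥ toPrime b n v = c • toPrime b n v ↔
      errOp p ω a d *ᵥ v = c • v := by
  rw [← toPrime_errOp_mulVec, ← map_smul, (toPrime b n).injective.eq_iff]

lemma errorClosed_map_toPrime_iff (b : Module.Basis (Fin m) (ZMod p) F) (n : ℕ)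
    {Q : Submodule ℂ ((Fin n → F) → ℂ)} :
    ErrorClosed p ω (Q.map (toPrime b n).toLinearMap) ↔ ErrorClosed p ω Q := by
  constructor
  · intro h v hv
    have h1 := h (toPrime b n v) ?_
    · obtain ⟨w, hw, h2⟩ := h1
      rwa [← (toPrime b n).injective h2]
    · intro a d c hc
      obtain ⟨a, rfl⟩ := (coords b n).surjective a
      obtain ⟨d, rfl⟩ := trCoords_surjective b n d
      rw [toPrime_errOp_eq_iff]
      exact hv a d c fun w hw =>
        (toPrime_errOp_eq_iff b n a d c w).1 (hc _ (Submodule.mem_map_of_mem hw))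
  · intro h v hv
    refine ⟨(toPrime b n).symm v, h _ fun a d c hc => ?_, (toPrime b n).apply_symm_apply v⟩
    rw [← toPrime_errOp_eq_iff b, LinearEquiv.apply_symm_apply]
    refine hv _ _ _ ?_
    rintro _ ⟨w, hw, rfl⟩
    exact (toPrime_errOp_eq_iff b n a d c w).2 (hc w hw)

/-- The factors of a local operator on `nm` qudits of dimension `p`, grouped into `n` qudits. -/
def groupFactors (b : Module.Basis (Fin m) (ZMod p) F) (n : ℕ)
    (U : Fin (n * m) → Matrix (ZMod p) (ZMod p) ℂ) (i : Fin n) : Matrix F F ℂ :=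
  (monomialOp 1 fun j : Fin m => U (finProdFinEquiv (i, j))).submatrix b.equivFun b.equivFun

lemma monomialOp_groupFactors (b : Module.Basis (Fin m) (ZMod p) F) (n : ℕ)
    (U : Fin (n * m) → Matrix (ZMod p) (ZMod p) ℂ) :
    monomialOp 1 (groupFactors b n U) =
      (monomialOp 1 U).submatrix (coords b n) (coords b n) := by
  ext u v
  simp only [monomialOp, groupFactors, Matrix.submatrix_apply, Matrix.of_apply, Equiv.Perm.coe_one,
    id]
  rw [← finProdFinEquiv.prod_comp, Fintype.prod_prod_type]
  simp only [coords_apply]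

lemma groupFactors_mem_unitaryGroup (b : Module.Basis (Fin m) (ZMod p) F) (n : ℕ)
    {U : Fin (n * m) → Matrix (ZMod p) (ZMod p) ℂ}
    (hU : ∀ l, U l ∈ Matrix.unitaryGroup (ZMod p) ℂ) (i : Fin n) :
    groupFactors b n U i ∈ Matrix.unitaryGroup F ℂ := by
  rw [Matrix.mem_unitaryGroup_iff']
  have h : star (groupFactors b n U i) = groupFactors b n (fun l => star (U l)) i := by
    ext u v
    simp [groupFactors, monomialOp, Matrix.star_apply]
  have h1 := monomialOp_star_mul fun j => hU (finProdFinEquiv (i, j))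
  rw [h, groupFactors, groupFactors]
  change Matrix.submatrix _ b.equivFun.toEquiv b.equivFun.toEquiv *
    Matrix.submatrix _ b.equivFun.toEquiv b.equivFun.toEquiv = _
  rw [Matrix.submatrix_mul_equiv, h1, Matrix.submatrix_one_equiv]

/-- The `m` unitaries of one block tensor together to a unitary on one copy of `ℂ^F`. A permutation
of the `nm` factors could mix the blocks, hence the restriction to local equivalence. -/
lemma LocallyEquivalent.of_map_toPrime (b : Module.Basis (Fin m) (ZMod p) F) (n : ℕ)
    {Q Q' : Submodule ℂ ((Fin n → F) → ℂ)}
    (h : LocallyEquivalent p ω (Q.map (toPrime b n).toLinearMap)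
      (Q'.map (toPrime b n).toLinearMap)) : LocallyEquivalent p ω Q Q' := by
  obtain ⟨U, hU, hP, h⟩ := h
  refine ⟨groupFactors b n U, groupFactors_mem_unitaryGroup b n hU, ?_, ?_⟩
  · intro a d
    obtain ⟨c, a', d', h⟩ := hP (coords b n a) (trCoords b n d)
    obtain ⟨a', rfl⟩ := (coords b n).surjective a'
    obtain ⟨d', rfl⟩ := trCoords_surjective b n d'
    refine ⟨c, a', d', ?_⟩
    change _ * errOp p ω _ _ = _ • errOp p ω _ _ * _ at h ⊢
    rw [monomialOp_groupFactors, errOp_eq_submatrix b, errOp_eq_submatrix b,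
      Matrix.submatrix_mul_equiv, h, Matrix.smul_mul, Matrix.smul_mul, Matrix.submatrix_mul_equiv]
    rfl
  · apply Submodule.map_injective_of_injective (toPrime b n).injective
    rw [h, ← Submodule.map_comp, ← Submodule.map_comp]
    congr 1
    refine LinearMap.ext fun v => ?_
    simp only [LinearMap.comp_apply, Matrix.mulVecLin_apply, LinearEquiv.coe_coe]
    rw [monomialOp_groupFactors, toPrime_submatrix_mulVec]

end Transfer

/-! ### Fourier matrices, quadratic phases, and the isotropic space of a code. -/

section LocalUnitaries

variable {p : ℕ} [Fact p.Prime] {ι : Type*} [Fintype ι] [DecidableEq ι] {ω : ℂ}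

/-- The Fourier matrix on one qudit of dimension `p`. -/
def fourierMatrix (p : ℕ) [Fact p.Prime] (ω : ℂ) : Matrix (ZMod p) (ZMod p) ℂ :=
  Matrix.of fun u v => ((Real.sqrt p : ℝ) : ℂ)⁻¹ * phase ω (u * v)

lemma fourierMatrix_mem_unitaryGroup (hω : IsPrimitiveRoot ω p) :
    fourierMatrix p ω ∈ Matrix.unitaryGroup (ZMod p) ℂ := by
  rw [Matrix.mem_unitaryGroup_iff']
  have hp : (p : ℂ) ≠ 0 := Nat.cast_ne_zero.2 (NeZero.ne p)
  have hs : ((Real.sqrt p : ℝ) : ℂ) * ((Real.sqrt p : ℝ) : ℂ) = p := by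
    rw [← Complex.ofReal_mul, Real.mul_self_sqrt (Nat.cast_nonneg p), Complex.ofReal_natCast]
  ext u v
  simp only [Matrix.mul_apply, Matrix.star_apply, fourierMatrix, Matrix.of_apply, star_mul',
    star_phase hω, star_inv₀]
  have h1 : star ((Real.sqrt p : ℝ) : ℂ) = ((Real.sqrt p : ℝ) : ℂ) := Complex.conj_ofReal _
  have h2 : ∀ t : ZMod p, ((Real.sqrt p : ℝ) : ℂ)⁻¹ * phase ω (-(t * u)) *
      (((Real.sqrt p : ℝ) : ℂ)⁻¹ * phase ω (t * v)) = (p : ℂ)⁻¹ * phase ω ((v - u) * t) := by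
    intro t
    rw [mul_mul_mul_comm, ← mul_inv, hs, ← phase_add hω]
    congr 2
    ring
  simp only [h1, h2]
  rw [← Finset.mul_sum, sum_phase_mul hω, Matrix.one_apply]
  by_cases h : u = v
  · simp [h, hp]
  · rw [if_neg (fun h' => h (sub_eq_zero.1 h').symm), if_neg h, mul_zero]

lemma locErr_apply (a d u v : ZMod p) :
    locErr p ω a d u v = if u = v + a then phase ω (d * v) else 0 := by
  simp [locErr]

lemma mul_locErr_apply (A : Matrix (ZMod p) (ZMod p) ℂ) (a d u v : ZMod p) :
    (A * locErr p ω a d) u v = A u (v + a) * phase ω (d * v) := by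
  simp [Matrix.mul_apply, locErr_apply]

lemma locErr_mul_apply (A : Matrix (ZMod p) (ZMod p) ℂ) (a d u v : ZMod p) :
    (locErr p ω a d * A) u v = phase ω (d * (u - a)) * A (u - a) v := by
  simp only [Matrix.mul_apply, locErr_apply, ← sub_eq_iff_eq_add]
  simp

/-- Conjugation by the Fourier matrix is the symplectic rotation `(a, d) ↦ (-d, a)`. -/
lemma fourierMatrix_mul_locErr (hω : IsPrimitiveRoot ω p) (a d : ZMod p) :
    fourierMatrix p ω * locErr p ω a d =
      phase ω (-(a * d)) • (locErr p ω (-d) a * fourierMatrix p ω) := by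
  ext u v
  rw [Matrix.smul_apply, smul_eq_mul, mul_locErr_apply, locErr_mul_apply]
  simp only [fourierMatrix, Matrix.of_apply]
  rw [mul_left_comm (phase ω (a * (u - -d))), mul_left_comm (phase ω (-(a * d))), mul_assoc,
    ← phase_add hω, ← phase_add hω, ← phase_add hω]
  congr 2
  ring

/-- The function `θ` is a quadratic phase with polar form `s * a * v`; conjugation by it is the
symplectic shear `(a, d) ↦ (a, d + s * a)`. -/
lemma diagonal_mul_locErr {θ : ZMod p → ℂ} {s : ZMod p}
    (hθ : ∀ v a, θ (v + a) = θ v * θ a * phase ω (s * a * v)) (hω : IsPrimitiveRoot ω p)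
    (a d : ZMod p) :
    Matrix.diagonal θ * locErr p ω a d =
      θ a • (locErr p ω a (d + s * a) * Matrix.diagonal θ) := by
  ext u v
  simp only [Matrix.diagonal_mul, Matrix.smul_apply, Matrix.mul_diagonal, locErr_apply, smul_eq_mul]
  split_ifs with h
  · rw [h, hθ, add_mul, phase_add hω]
    ring
  · simp

lemma diagonal_mem_unitaryGroup {θ : ZMod p → ℂ} (hθ : ∀ v, ‖θ v‖ = 1) :
    Matrix.diagonal θ ∈ Matrix.unitaryGroup (ZMod p) ℂ := by
  rw [Matrix.mem_unitaryGroup_iff', Matrix.star_eq_conjTranspose, Matrix.diagonal_conjTranspose,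
    Matrix.diagonal_mul_diagonal, ← Matrix.diagonal_one]
  congr 1
  ext v
  simp [Complex.conj_mul', hθ]

lemma monomialOp_diagonal_mulVec (θ : ι → ZMod p → ℂ) (v : (ι → ZMod p) → ℂ) (y : ι → ZMod p) :
    (monomialOp 1 (fun i => Matrix.diagonal (θ i)) *ᵥ v) y = (∏ i, θ i (y i)) * v y := by
  have h : monomialOp 1 (fun i => Matrix.diagonal (θ i)) =
      Matrix.diagonal fun y => ∏ i, θ i (y i) := by
    ext u v
    simp only [monomialOp, Matrix.of_apply, Equiv.Perm.coe_one, id, Matrix.diagonal_apply]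
    split_ifs with h
    · simp [h]
    · obtain ⟨i, hi⟩ := Function.ne_iff.1 h
      exact Finset.prod_eq_zero (Finset.mem_univ i) (if_neg hi)
  rw [h, Matrix.mulVec_diagonal]

/-- Quadratic phases. For `p = 2` they are not powers of `ω` but of a fourth root of unity. -/
lemma exists_quadratic_phase (hω : IsPrimitiveRoot ω p) (s : ZMod p) :
    ∃ θ : ZMod p → ℂ, (∀ v, ‖θ v‖ = 1) ∧
      ∀ v a, θ (v + a) = θ v * θ a * phase ω (s * a * v) := by
  by_cases hp : p = 2
  · subst hp
    obtain rfl : ω = -1 := hω.eq_neg_one_of_two_right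
    refine ⟨fun v => Complex.I ^ (s.val * v.val), fun v => by simp, fun v a => ?_⟩
    have hcases : ∀ t : ZMod 2, t = 0 ∨ t = 1 := by
      intro t
      fin_cases t
      exacts [Or.inl rfl, Or.inr rfl]
    have e1 : (1 : ZMod 2).val = 1 := rfl
    have e2 : (1 : ZMod 2) + 1 = 0 := rfl
    obtain rfl | rfl := hcases s <;> obtain rfl | rfl := hcases v <;> obtain rfl | rfl := hcases a <;>
      simp [phase, e1, e2]
  · have h2 : (2 : ZMod p) ≠ 0 := by
      intro h
      exact ZMod.prime_ne_zero p 2 hp (by exact_mod_cast h)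
    refine ⟨fun v => phase ω (s / 2 * v ^ 2), fun v => norm_phase hω _, fun v a => ?_⟩
    simp only [← phase_add hω]
    have h3 : s * a * v = s / 2 * (2 * a * v) := by field_simp
    rw [h3]
    congr 1
    ring

/-- The errors that act as scalars on `Q`. -/
def errSpace (hω : IsPrimitiveRoot ω p) (Q : Submodule ℂ ((ι → ZMod p) → ℂ)) :
    Submodule (ZMod p) ((ι → ZMod p) × (ι → ZMod p)) :=
  let S : AddSubmonoid ((ι → ZMod p) × (ι → ZMod p)) :=
    { carrier := {x | ∃ c : ℂ, ∀ w ∈ Q, errOp p ω x.1 x.2 *ᵥ w = c • w}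
      zero_mem' := ⟨1, fun w _ => by
        rw [Prod.fst_zero, Prod.snd_zero, errOp_zero, Matrix.one_mulVec, one_smul]⟩
      add_mem' := by
        rintro ⟨a, d⟩ ⟨a', d'⟩ ⟨c, hc⟩ ⟨c', hc'⟩
        refine ⟨(phase ω (trDot p d a'))⁻¹ * (c' * c), fun w hw => ?_⟩
        rw [mul_smul, eq_inv_smul_iff₀ (phase_ne_zero hω _), Prod.fst_add, Prod.snd_add,
          ← Matrix.smul_mulVec, ← errOp_mul hω, ← Matrix.mulVec_mulVec, hc' w hw,
          Matrix.mulVec_smul, hc w hw, smul_smul] }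
  { S with
    smul_mem' := fun t x hx => by
      rw [← ZMod.natCast_zmod_val t, Nat.cast_smul_eq_nsmul]
      exact S.nsmul_mem hx _ }

/-- Two errors acting as scalars commute on a nonzero vector, so their commutator phase, which is
the symplectic form, is trivial. -/
lemma errSpace_isotropic {hω : IsPrimitiveRoot ω p} {Q : Submodule ℂ ((ι → ZMod p) → ℂ)}
    (hQ : Q ≠ ⊥) {a d a' d' : ι → ZMod p} (h : (a, d) ∈ errSpace hω Q)
    (h' : (a', d') ∈ errSpace hω Q) : d ⬝ᵥ a' = d' ⬝ᵥ a := by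
  obtain ⟨v, hv, hne⟩ := Q.ne_bot_iff.1 hQ
  obtain ⟨c, hc⟩ := h
  obtain ⟨c', hc'⟩ := h'
  simp only at hc hc'
  have hcomp : (errOp p ω a' d' * errOp p ω a d) *ᵥ v = (c * c') • v := by
    rw [← Matrix.mulVec_mulVec, hc v hv, Matrix.mulVec_smul, hc' v hv, smul_smul]
  have h1 : (errOp p ω a d * errOp p ω a' d') *ᵥ v = (c * c') • v := by
    rw [← Matrix.mulVec_mulVec, hc' v hv, Matrix.mulVec_smul, hc v hv, smul_smul, mul_comm]
  have h2 : (errOp p ω a' d' * errOp p ω a d) *ᵥ v ≠ 0 := by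
    intro h0
    apply hne
    have h3 := congrArg (fun u => ((errUnit hω a' d' * errUnit hω a d)⁻¹).val *ᵥ u) h0
    have h4 : ((errUnit hω a' d' * errUnit hω a d)⁻¹).val * (errOp p ω a' d' * errOp p ω a d) = 1 :=
      (errUnit hω a' d' * errUnit hω a d).inv_mul
    simpa only [Matrix.mulVec_mulVec, h4, Matrix.one_mulVec, Matrix.mulVec_zero] using h3
  rw [errOp_comm hω, Matrix.smul_mulVec, ← hcomp] at h1
  have h5 : phase ω (trDot p d a' - trDot p d' a) = 1 :=
    smul_left_injective ℂ h2 (by simpa using h1)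
  rw [phase_eq_one_iff hω, trDot_zmod, trDot_zmod, sub_eq_zero] at h5
  exact h5

lemma mem_errSpace_of_map {hω : IsPrimitiveRoot ω p} {Q : Submodule ℂ ((ι → ZMod p) → ℂ)}
    {U : ι → Matrix (ZMod p) (ZMod p) ℂ} (hU : ∀ i, U i ∈ Matrix.unitaryGroup (ZMod p) ℂ)
    {a d a' d' : ι → ZMod p} {c : ℂ}
    (h : monomialOp 1 U * errOp p ω a d = c • errOp p ω a' d' * monomialOp 1 U)
    (h' : (a', d') ∈ errSpace hω (Q.map (Matrix.mulVecLin (monomialOp 1 U)))) :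
    (a, d) ∈ errSpace hω Q := by
  obtain ⟨s, hs⟩ := h'
  refine ⟨c * s, fun w hw => ?_⟩
  have h1 := hs _ (Submodule.mem_map_of_mem hw)
  rw [Matrix.mulVecLin_apply] at h1
  simp only at h1 ⊢
  rw [← Matrix.one_mulVec (errOp p ω a d *ᵥ w), ← monomialOp_star_mul hU, ← Matrix.mulVec_mulVec,
    Matrix.mulVec_mulVec _ _ (errOp p ω a d), h, Matrix.smul_mul, Matrix.smul_mulVec,
    ← Matrix.mulVec_mulVec, h1, smul_smul, Matrix.mulVec_smul, Matrix.mulVec_mulVec,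
    monomialOp_star_mul hU, Matrix.one_mulVec]

end LocalUnitaries

/-! ### Information sets and isotropic subspaces. -/

section LinearAlgebra

variable {K : Type*} [Field K] {ι : Type*} [Fintype ι] [DecidableEq ι]

/-- A subspace of `K^ι` has an information set `J`: its elements are determined by their entries
in `J`, and no nonzero vector supported in `J` is orthogonal to it. -/
lemma exists_informationSet (D : Submodule K (ι → K)) :
    ∃ J : Finset ι, (∀ d ∈ D, (∀ i ∈ J, d i = 0) → d = 0) ∧
      ∀ a : ι → K, (∀ i ∉ J, a i = 0) → (∀ d ∈ D, a ⬝ᵥ d = 0) → a = 0 := by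
  -- Take `J` minimal. Then for each `i ∈ J` some `d ∈ D` vanishes on the rest of `J` but not at
  -- `i`, and pairing `a` with it isolates `a i`.
  obtain ⟨J, hJ, hmin⟩ := WellFounded.has_min (wellFounded_lt (α := Finset ι))
    {J | ∀ d ∈ D, (∀ i ∈ J, d i = 0) → d = 0}
    ⟨Finset.univ, fun d _ h => funext fun i => h i (Finset.mem_univ i)⟩
  refine ⟨J, hJ, fun a ha hD => funext fun i => ?_⟩
  by_cases hi : i ∈ J
  · have h1 : ¬ _ := fun h => hmin (J.erase i) h (Finset.erase_ssubset hi)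
    change ¬ ∀ d ∈ D, (∀ j ∈ J.erase i, d j = 0) → d = 0 at h1
    push Not at h1
    obtain ⟨d, hd, hd0, hne⟩ := h1
    have h2 : d i ≠ 0 := fun h0 => hne (hJ d hd fun j hj => by
      by_cases hji : j = i
      · rwa [hji]
      · exact hd0 j (Finset.mem_erase.2 ⟨hji, hj⟩))
    have h3 := hD d hd
    rw [dotProduct, Finset.sum_eq_single i] at h3
    · exact (mul_eq_zero.1 h3).resolve_right h2
    · intro j _ hji
      by_cases hj : j ∈ J
      · rw [hd0 j (Finset.mem_erase.2 ⟨hji, hj⟩), mul_zero]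
      · rw [ha j hj, zero_mul]
    · simp
  · exact ha i hi

/-- An isotropic subspace that meets `0 × K^ι` trivially lies in the graph of a symmetric matrix. -/
lemma exists_symm_matrix_of_isotropic (C : Submodule K ((ι → K) × (ι → K)))
    (hiso : ∀ a d a' d', (a, d) ∈ C → (a', d') ∈ C → d ⬝ᵥ a' = d' ⬝ᵥ a)
    (hC : ∀ d, (0, d) ∈ C → d = 0) :
    ∃ Γ : Matrix ι ι K, Γ.IsSymm ∧ ∀ a d, (a, d) ∈ C → d = Γ *ᵥ a := by
  let f : C →ₗ[K] (ι → K) := LinearMap.fst K _ _ ∘ₗ C.subtype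
  have hf : LinearMap.ker f = ⊥ := by
    rw [LinearMap.ker_eq_bot']
    rintro ⟨⟨a, d⟩, h⟩ (h0 : a = 0)
    subst h0
    exact Subtype.ext (Prod.ext rfl (hC d h))
  obtain ⟨g, hg⟩ := f.exists_leftInverse_of_injective hf
  let Φ : (ι → K) →ₗ[K] (ι → K) := LinearMap.snd K _ _ ∘ₗ C.subtype ∘ₗ g
  let P : (ι → K) →ₗ[K] (ι → K) := LinearMap.fst K _ _ ∘ₗ C.subtype ∘ₗ g
  have hmem : ∀ u, (P u, Φ u) ∈ C := fun u => (g u).2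
  have hga : ∀ a d, (a, d) ∈ C → P a = a ∧ Φ a = d := by
    intro a d h
    have h1 : g a = ⟨(a, d), h⟩ := LinearMap.congr_fun hg ⟨(a, d), h⟩
    exact ⟨by simp only [P, LinearMap.comp_apply, h1]; rfl,
      by simp only [Φ, LinearMap.comp_apply, h1]; rfl⟩
  let A := LinearMap.toMatrix' Φ
  let R := LinearMap.toMatrix' P
  have hA : ∀ u, A *ᵥ u = Φ u := fun u => LinearMap.toMatrix'_mulVec Φ u
  have hR : ∀ u, R *ᵥ u = P u := fun u => LinearMap.toMatrix'_mulVec P u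
  have hsymm : Aᵀ * R = Rᵀ * A := by
    ext i j
    have h1 := hiso _ _ _ _ (hmem (Pi.single i 1)) (hmem (Pi.single j 1))
    rw [← hA, ← hR, ← hA, ← hR] at h1
    simp only [Matrix.mulVec_single_one, dotProduct, Matrix.col_apply] at h1
    simp only [Matrix.mul_apply, Matrix.transpose_apply]
    rw [h1]
    exact Finset.sum_congr rfl fun _ _ => mul_comm _ _
  -- Isotropy makes `Aᵀ * R` symmetric. On shifts `a` occurring in `C` one has `R a = a`, so the two
  -- terms with `Aᵀ` cancel and `A a = d` remains.
  refine ⟨Aᵀ + A - Aᵀ * R, ?_, fun a d h => ?_⟩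
  · rw [Matrix.IsSymm, Matrix.transpose_sub, Matrix.transpose_add, Matrix.transpose_mul,
      Matrix.transpose_transpose, ← hsymm, add_comm]
  · rw [Matrix.sub_mulVec, Matrix.add_mulVec, ← Matrix.mulVec_mulVec, hR, (hga a d h).1, hA,
      (hga a d h).2, add_sub_cancel_left]

end LinearAlgebra

/-! ### Bringing the error space into the graph of a symmetric matrix. -/

section NormalForm

variable {p : ℕ} [Fact p.Prime] {ι : Type*} [Fintype ι] [DecidableEq ι] {ω : ℂ}

lemma exists_locallyEquivalent_transversal (hω : IsPrimitiveRoot ω p)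
    {Q : Submodule ℂ ((ι → ZMod p) → ℂ)} (hQ : Q ≠ ⊥) :
    ∃ Q', LocallyEquivalent p ω Q Q' ∧ ∀ d, (0, d) ∈ errSpace hω Q' → d = 0 := by
  obtain ⟨J, hJ1, hJ2⟩ := exists_informationSet ((errSpace hω Q).comap (LinearMap.inr _ _ _))
  let U : ι → Matrix (ZMod p) (ZMod p) ℂ := fun i => if i ∈ J then fourierMatrix p ω else 1
  have hU : ∀ i, U i ∈ Matrix.unitaryGroup (ZMod p) ℂ := by
    intro i
    simp only [U]
    split_ifs
    · exact fourierMatrix_mem_unitaryGroup hω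
    · exact one_mem _
  have key : ∀ a d : ι → ZMod p, monomialOp 1 U * errOp p ω a d =
      (∏ i, if i ∈ J then phase ω (-(a i * d i)) else 1) •
        errOp p ω (fun i => if i ∈ J then -d i else a i) (fun i => if i ∈ J then a i else d i) *
          monomialOp 1 U := by
    intro a d
    refine monomialOp_mul_errOp hω fun i => ?_
    by_cases hi : i ∈ J
    · simp only [U, hi, if_true, fourierMatrix_mul_locErr hω]
    · simp only [U, hi, if_false, Matrix.one_mul, Matrix.mul_one, one_smul]
  refine ⟨_, ⟨U, hU, fun a d => ⟨_, _, _, key a d⟩, rfl⟩, fun d hd => ?_⟩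
  -- This error is the one that the Fourier matrices send to the pure phase error `d`: its shift
  -- part is `d` on `J`, its phase part is `d` off `J`.
  have h1 := key (fun i => if i ∈ J then d i else 0) (fun i => if i ∈ J then 0 else d i)
  have e1 : (fun i => if i ∈ J then -(if i ∈ J then 0 else d i) else if i ∈ J then d i else 0) =
      (0 : ι → ZMod p) := by
    ext i
    by_cases hi : i ∈ J <;> simp [hi]
  have e2 : (fun i => if i ∈ J then (if i ∈ J then d i else 0) else if i ∈ J then 0 else d i) =
      d := by
    ext i
    by_cases hi : i ∈ J <;> simp [hi]
  rw [e1, e2] at h1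
  have h2 := mem_errSpace_of_map hU h1 hd
  -- Isotropy against the pure phase errors of `Q` makes the shift part orthogonal to them, and it
  -- is supported in `J`.
  have h3 : (fun i => if i ∈ J then d i else 0) = 0 := by
    refine hJ2 _ (fun i hi => if_neg hi) fun e he => ?_
    have h4 := errSpace_isotropic hQ h2 (a' := 0) (d' := e) he
    rw [dotProduct_zero] at h4
    rw [dotProduct_comm, ← h4]
  rw [h3] at h2
  have h5 : (fun i => if i ∈ J then 0 else d i) = 0 := hJ1 _ h2 fun i hi => if_pos hi
  ext i
  have h6 := congrFun h3 i
  have h7 := congrFun h5 i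
  by_cases hi : i ∈ J
  · simpa [hi] using h6
  · simpa [hi] using h7

lemma locallyEquivalent_diagonal (hω : IsPrimitiveRoot ω p) (Q : Submodule ℂ ((ι → ZMod p) → ℂ))
    {θ : ι → ZMod p → ℂ} {s : ι → ZMod p} (hn : ∀ i v, ‖θ i v‖ = 1)
    (hθ : ∀ i v a, θ i (v + a) = θ i v * θ i a * phase ω (s i * a * v)) :
    LocallyEquivalent p ω Q
      (Q.map (Matrix.mulVecLin (monomialOp 1 fun i => Matrix.diagonal (θ i)))) :=
  ⟨_, fun i => diagonal_mem_unitaryGroup (hn i), fun _ _ =>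
    ⟨_, _, _, monomialOp_mul_errOp hω fun i => diagonal_mul_locErr (hθ i) hω _ _⟩, rfl⟩

/-- Every nonzero code is locally equivalent to one whose errors lie in the graph of a symmetric
matrix with zero diagonal. -/
lemma exists_locallyEquivalent_graph (hω : IsPrimitiveRoot ω p)
    {Q : Submodule ℂ ((ι → ZMod p) → ℂ)} (hQ : Q ≠ ⊥) :
    ∃ (Q' : Submodule ℂ ((ι → ZMod p) → ℂ)) (C : Matrix ι ι (ZMod p)),
      LocallyEquivalent p ω Q Q' ∧ C.IsSymm ∧ (∀ i, C i i = 0) ∧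
        ∀ a d, (a, d) ∈ errSpace hω Q' → d = C *ᵥ a := by
  obtain ⟨Q₁, hQ₁, h1⟩ := exists_locallyEquivalent_transversal hω hQ
  obtain ⟨Γ, hΓ, h2⟩ := exists_symm_matrix_of_isotropic (errSpace hω Q₁)
    (fun a d a' d' h h' => errSpace_isotropic (hQ₁.ne_bot hQ) h h') h1
  -- The shear by `-Γ i i` in factor `i` subtracts the diagonal of `Γ`, as a loopless graph
  -- requires.
  choose θ hn hθ using fun i => exists_quadratic_phase hω (-Γ i i)
  refine ⟨_, Γ - Matrix.diagonal fun i => Γ i i,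
    hQ₁.trans (locallyEquivalent_diagonal hω Q₁ hn hθ), ?_, by simp, fun a d h => ?_⟩
  · rw [Matrix.IsSymm, Matrix.transpose_sub, hΓ.eq, Matrix.diagonal_transpose]
  · have h3 : (a, fun i => d i + Γ i i * a i) ∈ errSpace hω Q₁ := by
      refine mem_errSpace_of_map (fun i => diagonal_mem_unitaryGroup (hn i))
        (monomialOp_mul_errOp hω (a' := a) (d' := d) (c := fun i => θ i (a i)) fun i => ?_) h
      rw [diagonal_mul_locErr (hθ i) hω]
      congr 3
      ring
    have h4 := h2 _ _ h3
    ext i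
    have h5 := congrFun h4 i
    rw [Matrix.sub_mulVec, Pi.sub_apply, ← h5, Matrix.mulVec_diagonal]
    ring

end NormalForm

/-! ### The quadratic form of a graph. -/

section QuadForm

variable {R : Type*} [CommRing R] {N : ℕ}

lemma sum_Ioi_eq_sum_ite {M : Type*} [AddCommMonoid M] (i : Fin N) (f : Fin N → M) :
    ∑ j ∈ Finset.Ioi i, f j = ∑ j, if i < j then f j else 0 := by
  rw [← Finset.sum_filter]
  congr 1
  ext j
  simp

lemma sum_sum_eq_sum_Ioi {M : Type*} [AddCommMonoid M] (f : Fin N → Fin N → M)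
    (hf : ∀ i, f i i = 0) :
    ∑ i, ∑ j, f i j = ∑ i, ∑ j ∈ Finset.Ioi i, (f i j + f j i) := by
  simp only [Finset.sum_add_distrib]
  have h : ∑ i, ∑ j ∈ Finset.Ioi i, f j i = ∑ i, ∑ j, if j < i then f i j else 0 := by
    simp only [sum_Ioi_eq_sum_ite]
    exact Finset.sum_comm
  rw [h]
  simp only [sum_Ioi_eq_sum_ite, ← Finset.sum_add_distrib]
  refine Finset.sum_congr rfl fun i _ => Finset.sum_congr rfl fun j _ => ?_
  rcases lt_trichotomy i j with h | h | h
  · simp [h, h.not_gt]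
  · simp [h, hf]
  · simp [h, h.not_gt]

/-- The polar form of `quadForm C` is `C` itself. Summing over `i < j` avoids a division by two, so
`p = 2` needs no separate treatment. -/
lemma quadForm_add {C : Matrix (Fin N) (Fin N) R} (hC : C.IsSymm) (h0 : ∀ i, C i i = 0)
    (y a : Fin N → R) :
    quadForm C (y + a) = quadForm C y + quadForm C a + (C *ᵥ a) ⬝ᵥ y := by
  have h : (C *ᵥ a) ⬝ᵥ y = ∑ i, ∑ j, C i j * a j * y i := by
    simp only [dotProduct, Matrix.mulVec, Finset.sum_mul]
  rw [h, sum_sum_eq_sum_Ioi _ (by simp [h0])]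
  simp only [quadForm, ← Finset.sum_add_distrib]
  refine Finset.sum_congr rfl fun i _ => Finset.sum_congr rfl fun j _ => ?_
  rw [hC.apply i j, Pi.add_apply, Pi.add_apply]
  ring

lemma quadForm_zero (C : Matrix (Fin N) (Fin N) R) : quadForm C 0 = 0 := by
  simp [quadForm]

end QuadForm

/-! ### Graph codes, their spanning states and their stabilizers. -/

section GraphCode

variable {p : ℕ} [Fact p.Prime] {N : ℕ} {κ : Type*} [Fintype κ] [DecidableEq κ] {ω : ℂ}

/-- The phases of the graph with adjacency matrix `C`. -/
def graphFun (ω : ℂ) (C : Matrix (Fin N) (Fin N) (ZMod p)) (y : Fin N → ZMod p) : ℂ :=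
  phase ω (quadForm C y)

lemma graphFun_ne_zero (hω : IsPrimitiveRoot ω p) (C : Matrix (Fin N) (Fin N) (ZMod p))
    (y : Fin N → ZMod p) : graphFun ω C y ≠ 0 := phase_ne_zero hω _

/-- The functions which, after division by the phases of a graph, are invariant under the
translations by `W`. -/
def graphCode (ω : ℂ) (C : Matrix (Fin N) (Fin N) (ZMod p))
    (W : Submodule (ZMod p) (Fin N → ZMod p)) : Submodule ℂ ((Fin N → ZMod p) → ℂ) where
  carrier := {v | ∀ a ∈ W, ∀ y, graphFun ω C y * v (y - a) = graphFun ω C (y - a) * v y}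
  zero_mem' := by intro a _ y; simp
  add_mem' := by
    intro v w hv hw a ha y
    simp only [Pi.add_apply, mul_add, hv a ha y, hw a ha y]
  smul_mem' := by
    intro c v hv a ha y
    simp only [Pi.smul_apply, smul_eq_mul, mul_left_comm _ c, hv a ha y]

lemma mem_graphCode {C : Matrix (Fin N) (Fin N) (ZMod p)} {W : Submodule (ZMod p) (Fin N → ZMod p)}
    {v : (Fin N → ZMod p) → ℂ} :
    v ∈ graphCode ω C W ↔
      ∀ a ∈ W, ∀ y, graphFun ω C y * v (y - a) = graphFun ω C (y - a) * v y := Iff.rfl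

/-- The right side is the shift by `a` conjugated by the diagonal matrix of graph phases. The
normalized errors therefore multiply exactly as shifts do, without extra phases. -/
lemma errOp_mulVec_graph (hω : IsPrimitiveRoot ω p) {C : Matrix (Fin N) (Fin N) (ZMod p)}
    (hC : C.IsSymm) (h0 : ∀ i, C i i = 0) (a : Fin N → ZMod p) (v : (Fin N → ZMod p) → ℂ)
    (y : Fin N → ZMod p) :
    phase ω (quadForm C a) * (errOp p ω a (C *ᵥ a) *ᵥ v) y =
      graphFun ω C y / graphFun ω C (y - a) * v (y - a) := by
  rw [errOp_mulVec, trDot_zmod, graphFun, graphFun, ← phase_sub hω, ← mul_assoc, ← phase_add hω]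
  congr 2
  have h := quadForm_add hC h0 (y - a) a
  rw [sub_add_cancel] at h
  rw [h]
  ring

lemma mem_graphCode_iff_errOp (hω : IsPrimitiveRoot ω p) {C : Matrix (Fin N) (Fin N) (ZMod p)}
    (hC : C.IsSymm) (h0 : ∀ i, C i i = 0) {W : Submodule (ZMod p) (Fin N → ZMod p)}
    {v : (Fin N → ZMod p) → ℂ} :
    v ∈ graphCode ω C W ↔ ∀ a ∈ W,
      (phase ω (quadForm C a) • errOp p ω a (C *ᵥ a)) *ᵥ v = v := by
  rw [mem_graphCode]
  refine forall₂_congr fun a _ => ?_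
  rw [funext_iff]
  refine forall_congr' fun y => ?_
  rw [Matrix.smul_mulVec, Pi.smul_apply, smul_eq_mul, errOp_mulVec_graph hω hC h0, div_mul_eq_mul_div,
    div_eq_iff (graphFun_ne_zero hω C _), mul_comm (v y)]

/-- The state with input `x`, up to the factor `g x`. -/
def inputState (ω : ℂ) (C : Matrix (Fin N) (Fin N) (ZMod p)) (B : Matrix κ (Fin N) (ZMod p))
    (g : (κ → ZMod p) → ℂ) (x : κ → ZMod p) : (Fin N → ZMod p) → ℂ := fun y =>
  g x * (graphFun ω C y * phase ω (x ⬝ᵥ B *ᵥ y))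

lemma inputState_mem_graphCode (C : Matrix (Fin N) (Fin N) (ZMod p))
    (B : Matrix κ (Fin N) (ZMod p)) (g : (κ → ZMod p) → ℂ) (x : κ → ZMod p) :
    inputState ω C B g x ∈ graphCode ω C (LinearMap.ker B.mulVecLin) := by
  intro a ha y
  rw [LinearMap.mem_ker, Matrix.mulVecLin_apply] at ha
  simp only [inputState, Matrix.mulVec_sub, ha, sub_zero]
  ring

/-- Fourier expansion on `(ZMod p)^κ`. -/
lemma fourier_expansion (hω : IsPrimitiveRoot ω p) (u : (κ → ZMod p) → ℂ) (z : κ → ZMod p) :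
    u z = ∑ x : κ → ZMod p, (((p : ℂ) ^ Fintype.card κ)⁻¹ *
      ∑ z' : κ → ZMod p, u z' * phase ω (-(x ⬝ᵥ z'))) * phase ω (x ⬝ᵥ z) := by
  have hp : (p : ℂ) ^ Fintype.card κ ≠ 0 := pow_ne_zero _ (Nat.cast_ne_zero.2 (NeZero.ne p))
  have h : ∀ x : κ → ZMod p, (((p : ℂ) ^ Fintype.card κ)⁻¹ *
      ∑ z' : κ → ZMod p, u z' * phase ω (-(x ⬝ᵥ z'))) * phase ω (x ⬝ᵥ z) =
      ((p : ℂ) ^ Fintype.card κ)⁻¹ * ∑ z' : κ → ZMod p, u z' * phase ω ((z - z') ⬝ᵥ x) := by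
    intro x
    rw [mul_assoc, Finset.sum_mul]
    congr 1
    refine Finset.sum_congr rfl fun z' _ => ?_
    rw [mul_assoc, ← phase_add hω, sub_dotProduct, dotProduct_comm z, dotProduct_comm z']
    congr 2
    ring
  simp only [h]
  rw [← Finset.mul_sum, Finset.sum_comm]
  simp only [← Finset.mul_sum, sum_phase_dotProduct hω, sub_eq_zero]
  simp [mul_comm _ (_ ^ _), hp]

/-- After division by the graph phases, a vector of the code is invariant under the kernel of `B`.
It is therefore a function of `B y`, and expanding that function in characters exhibits the input
states. -/
lemma span_inputState (hω : IsPrimitiveRoot ω p) (C : Matrix (Fin N) (Fin N) (ZMod p))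
    (B : Matrix κ (Fin N) (ZMod p)) {g : (κ → ZMod p) → ℂ} (hg : ∀ x, g x ≠ 0) :
    Submodule.span ℂ (Set.range (inputState ω C B g)) =
      graphCode ω C (LinearMap.ker B.mulVecLin) := by
  refine le_antisymm (Submodule.span_le.2 ?_) fun v hv => ?_
  · rintro _ ⟨x, rfl⟩
    exact inputState_mem_graphCode C B g x
  · let w : (Fin N → ZMod p) → ℂ := fun y => v y / graphFun ω C y
    have hw : ∀ y y', B *ᵥ y = B *ᵥ y' → w y = w y' := by
      intro y y' h
      have h1 := hv (y - y') (by
        rw [LinearMap.mem_ker, Matrix.mulVecLin_apply, Matrix.mulVec_sub, h, sub_self]) y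
      rw [sub_sub_cancel] at h1
      simp only [w]
      rw [div_eq_div_iff (graphFun_ne_zero hω C _) (graphFun_ne_zero hω C _), mul_comm (v y), ← h1,
        mul_comm]
    -- Off the range of `B` the function is set to `0`; any other values would serve.
    have hu : ∀ y, Function.extend (B *ᵥ ·) w 0 (B *ᵥ y) = w y := fun y =>
      Function.FactorsThrough.extend_apply (f := (B *ᵥ ·)) (g := w) (fun y y' h => hw y y' h) 0 y
    obtain ⟨c, hexp⟩ : ∃ c : (κ → ZMod p) → ℂ, ∀ y, w y = ∑ x, c x * phase ω (x ⬝ᵥ B *ᵥ y) :=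
      ⟨_, fun y => (hu y).symm.trans
        (fourier_expansion hω (Function.extend (B *ᵥ ·) w 0) (B *ᵥ y))⟩
    have hv' : v = ∑ x, (c x / g x) • inputState ω C B g x := by
      ext y
      have h1 : v y = graphFun ω C y * w y := by
        simp only [w]
        rw [mul_div_cancel₀ _ (graphFun_ne_zero hω C y)]
      rw [h1, hexp y, Finset.mul_sum, Finset.sum_apply]
      refine Finset.sum_congr rfl fun x _ => ?_
      simp only [Pi.smul_apply, smul_eq_mul, inputState]
      have := hg x
      field_simp
    rw [hv']
    exact Submodule.sum_mem _ fun x _ => Submodule.smul_mem _ _ (Submodule.subset_span ⟨x, rfl⟩)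

/-- In the inner product the graph phases cancel and a character sum with parameter `(x' - x) B`
remains. -/
lemma orthonormal_inputState (hω : IsPrimitiveRoot ω p) (C : Matrix (Fin N) (Fin N) (ZMod p))
    {B : Matrix κ (Fin N) (ZMod p)} {g : (κ → ZMod p) → ℂ}
    (hg : ∀ x, ‖g x‖ ^ 2 * (p : ℝ) ^ N = 1) (hB : ∀ x, x ᵥ* B = 0 → x = 0) :
    Orthonormal ℂ fun x => WithLp.toLp 2 (inputState ω C B g x) := by
  rw [orthonormal_iff_ite]
  intro x x'
  rw [EuclideanSpace.inner_toLp_toLp]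
  have h : inputState ω C B g x' ⬝ᵥ star (inputState ω C B g x) =
      g x' * star (g x) * ∑ y : Fin N → ZMod p, phase ω (((x' - x) ᵥ* B) ⬝ᵥ y) := by
    rw [dotProduct, Finset.mul_sum]
    refine Finset.sum_congr rfl fun y _ => ?_
    simp only [Pi.star_apply, inputState, star_mul', graphFun, star_phase hω]
    rw [mul_mul_mul_comm, mul_mul_mul_comm (phase ω _), ← phase_add hω, ← phase_add hω,
      ← phase_add hω, ← Matrix.dotProduct_mulVec, sub_dotProduct]
    congr 2
    ring
  rw [h, sum_phase_dotProduct hω, Fintype.card_fin]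
  by_cases hx : x = x'
  · subst hx
    have h1 : g x * star (g x) = ((‖g x‖ ^ 2 : ℝ) : ℂ) := by
      rw [Complex.ofReal_pow]; exact Complex.mul_conj' _
    rw [sub_self, Matrix.zero_vecMul, if_pos rfl, if_pos rfl, h1]
    exact_mod_cast hg x
  · rw [if_neg hx, if_neg, mul_zero]
    intro h0
    exact hx (sub_eq_zero.1 (hB _ h0)).symm

/-- An input in the left kernel of `B` yields a multiple of the state with input `0`. -/
lemma eq_zero_of_linearIndependent_inputState {C : Matrix (Fin N) (Fin N) (ZMod p)}
    {B : Matrix κ (Fin N) (ZMod p)} {g : (κ → ZMod p) → ℂ} (hg : ∀ x, g x ≠ 0)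
    (hli : LinearIndependent ℂ (inputState ω C B g)) {x : κ → ZMod p} (hx : x ᵥ* B = 0) :
    x = 0 := by
  have h : g 0 • inputState ω C B g x = g x • inputState ω C B g 0 := by
    ext y
    simp only [Pi.smul_apply, smul_eq_mul, inputState, Matrix.dotProduct_mulVec, hx,
      zero_dotProduct, Matrix.zero_vecMul]
    ring
  by_contra hne
  have h2 := linearIndependent_iff'.1 hli {x, 0}
    (fun z => if z = x then g 0 else -g x) (by
      rw [Finset.sum_pair hne, if_pos rfl, if_neg (Ne.symm hne), h, neg_smul, add_neg_cancel]) x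
      (by simp)
  rw [if_pos rfl] at h2
  exact hg 0 h2

lemma graphCode_ne_bot (hω : IsPrimitiveRoot ω p) (C : Matrix (Fin N) (Fin N) (ZMod p))
    (W : Submodule (ZMod p) (Fin N → ZMod p)) : graphCode ω C W ≠ ⊥ := by
  refine (Submodule.ne_bot_iff _).2 ⟨graphFun ω C, fun a _ y => mul_comm _ _, fun h => ?_⟩
  exact graphFun_ne_zero hω C 0 (congrFun h 0)

lemma graphCode_errorClosed (hω : IsPrimitiveRoot ω p) {C : Matrix (Fin N) (Fin N) (ZMod p)}
    (hC : C.IsSymm) (h0 : ∀ i, C i i = 0) (W : Submodule (ZMod p) (Fin N → ZMod p)) :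
    ErrorClosed p ω (graphCode ω C W) := by
  intro v hv
  rw [mem_graphCode_iff_errOp hω hC h0]
  intro a ha
  have key : ∀ w, (phase ω (quadForm C a) • errOp p ω a (C *ᵥ a)) *ᵥ w = w ↔
      errOp p ω a (C *ᵥ a) *ᵥ w = (phase ω (quadForm C a))⁻¹ • w := by
    intro w
    rw [eq_inv_smul_iff₀ (phase_ne_zero hω _), Matrix.smul_mulVec]
  rw [key]
  exact hv _ _ _ fun w hw => (key w).1 ((mem_graphCode_iff_errOp hω hC h0).1 hw a ha)

/-- For `a ≠ 0` the scalar arises by moving a suitable `Z^e` past `X^a`. For `a = 0` it is required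
to be trivial, since without qudits the error group contains no scalar except `1`. -/
lemma phase_smul_errOp_mem (hω : IsPrimitiveRoot ω p) {ι : Type*} [Fintype ι] [DecidableEq ι]
    {a d : ι → ZMod p} {t : ZMod p} (h : a = 0 → t = 0)
    {g : (Matrix (ι → ZMod p) (ι → ZMod p) ℂ)ˣ}
    (hg : (g : Matrix (ι → ZMod p) (ι → ZMod p) ℂ) = phase ω t • errOp p ω a d) :
    g ∈ errorGroup p (ZMod p) ι ω := by
  by_cases ha : a = 0
  · refine Subgroup.subset_closure ⟨a, d, ?_⟩
    rw [hg, h ha, phase_zero, one_smul, errOp]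
  · obtain ⟨i, hi⟩ := Function.ne_iff.1 ha
    let e : ι → ZMod p := Pi.single i (t / a i)
    have he : e ⬝ᵥ a = t := by
      simp only [e, single_dotProduct]
      exact div_mul_cancel₀ _ hi
    have h1 : g = errUnit hω 0 e * errUnit hω a (d - e) := by
      apply Units.ext
      rw [hg, Units.val_mul]
      change _ = errOp p ω 0 e * errOp p ω a (d - e)
      rw [errOp_mul hω, trDot_zmod, he, zero_add, add_sub_cancel]
    rw [h1]
    exact mul_mem (errUnit_mem hω _ _) (errUnit_mem hω _ _)

/-- The stabilizer of a graph code. -/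
lemma mem_stabilizerOf_graphCode (hω : IsPrimitiveRoot ω p) {C : Matrix (Fin N) (Fin N) (ZMod p)}
    (hC : C.IsSymm) (h0 : ∀ i, C i i = 0) (B : Matrix κ (Fin N) (ZMod p))
    {g : (Matrix (Fin N → ZMod p) (Fin N → ZMod p) ℂ)ˣ} :
    g ∈ stabilizerOf p ω (graphCode ω C (LinearMap.ker B.mulVecLin)) ↔
      ∃ a, B *ᵥ a = 0 ∧ (g : Matrix (Fin N → ZMod p) (Fin N → ZMod p) ℂ) =
        phase ω (quadForm C a) • errOp p ω a (C *ᵥ a) := by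
  constructor
  · rintro ⟨hg, hfix⟩
    obtain ⟨t, a, d, h⟩ := exists_eq_phase_smul_errOp hω hg
    -- Comparing phases on the state with input `x` at the point `y + a`. Setting `x` and `y` to `0`
    -- or to unit vectors then determines `t`, `B a` and `d`.
    have h1 : ∀ x y, t + d ⬝ᵥ y - (C *ᵥ a) ⬝ᵥ y - quadForm C a - x ⬝ᵥ B *ᵥ a = 0 := by
      intro x y
      have h2 := congrFun (hfix _ (inputState_mem_graphCode C B 1 x)) (y + a)
      rw [h, Matrix.smul_mulVec, Pi.smul_apply, smul_eq_mul, errOp_mulVec, add_sub_cancel_right] at h2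
      simp only [inputState, Pi.one_apply, one_mul, graphFun, ← phase_add hω] at h2
      have h3 := phase_injective hω h2
      rw [quadForm_add hC h0, trDot_zmod, Matrix.mulVec_add, dotProduct_add] at h3
      linear_combination h3
    have ht : t = quadForm C a := by
      have := h1 0 0
      simp only [dotProduct_zero, zero_dotProduct] at this
      linear_combination this
    have hB : B *ᵥ a = 0 := by
      ext i
      have := h1 (Pi.single i 1) 0
      simp only [dotProduct_zero, single_dotProduct, one_mul] at this
      rw [Pi.zero_apply]
      linear_combination ht - this
    have hd : d = C *ᵥ a := by
      ext i
      have := h1 0 (Pi.single i 1)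
      simp only [dotProduct_single, zero_dotProduct, mul_one] at this
      linear_combination this - ht
    exact ⟨a, hB, by rw [h, ht, hd]⟩
  · rintro ⟨a, ha, h⟩
    refine ⟨phase_smul_errOp_mem hω (fun h => by rw [h, quadForm_zero]) h, fun v hv => ?_⟩
    rw [h]
    exact (mem_graphCode_iff_errOp hω hC h0).1 hv a ha

lemma mem_graphCode_iff_stabilizerOf (hω : IsPrimitiveRoot ω p)
    {C : Matrix (Fin N) (Fin N) (ZMod p)} (hC : C.IsSymm) (h0 : ∀ i, C i i = 0)
    (B : Matrix κ (Fin N) (ZMod p)) (v : (Fin N → ZMod p) → ℂ) :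
    v ∈ graphCode ω C (LinearMap.ker B.mulVecLin) ↔
      ∀ g ∈ stabilizerOf p ω (graphCode ω C (LinearMap.ker B.mulVecLin)),
        (g : Matrix (Fin N → ZMod p) (Fin N → ZMod p) ℂ) *ᵥ v = v := by
  refine ⟨fun hv g hg => hg.2 v hv, fun h => ?_⟩
  rw [mem_graphCode_iff_errOp hω hC h0]
  intro a ha
  have hinv : (phase ω (quadForm C a) • errOp p ω a (C *ᵥ a)) *
      ((phase ω (quadForm C a))⁻¹ • (errUnit hω a (C *ᵥ a))⁻¹.val) = 1 := by
    rw [Matrix.smul_mul, Matrix.mul_smul, smul_smul, mul_inv_cancel₀ (phase_ne_zero hω _), one_smul]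
    exact (errUnit hω a (C *ᵥ a)).mul_inv
  exact h ⟨_, _, hinv, mul_eq_one_comm.1 hinv⟩
    ((mem_stabilizerOf_graphCode hω hC h0 B).2 ⟨a, ha, rfl⟩)

end GraphCode

/-! ### Graph states over `F` in coordinates. -/

section GraphState

variable {p : ℕ} [Fact p.Prime] {F : Type*} [Field F] [Fintype F] [Algebra (ZMod p) F]
  {k n m : ℕ} {ω : ℂ}

lemma sum_Ioi_add {M : Type*} [AddCommMonoid M] (h : Fin (k + n) → Fin (k + n) → M) :
    ∑ i, ∑ j ∈ Finset.Ioi i, h i j =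
      ∑ i, ∑ j ∈ Finset.Ioi i, h (Fin.castAdd n i) (Fin.castAdd n j) +
      ∑ i, ∑ j, h (Fin.castAdd n i) (Fin.natAdd k j) +
      ∑ i, ∑ j ∈ Finset.Ioi i, h (Fin.natAdd k i) (Fin.natAdd k j) := by
  simp only [sum_Ioi_eq_sum_ite]
  simp only [Fin.sum_univ_add]
  have h1 : ∀ (i : Fin k) (j : Fin n), Fin.castAdd n i < Fin.natAdd k j := fun i j => by
    rw [Fin.lt_def]; simp; omega
  have h2 : ∀ (i : Fin n) (j : Fin k), ¬ Fin.natAdd k i < Fin.castAdd n j := fun i j =>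
    (h1 j i).not_gt
  have h3 : ∀ i j : Fin k, Fin.castAdd n i < Fin.castAdd n j ↔ i < j := fun i j => Iff.rfl
  have h4 : ∀ i j : Fin n, Fin.natAdd k i < Fin.natAdd k j ↔ i < j := fun i j => by
    simp
  simp only [h1, h2, h3, h4, if_true, if_false, Finset.sum_const_zero, zero_add,
    Finset.sum_add_distrib]

lemma phase_intCast_mul (hω : IsPrimitiveRoot ω p) (z : ℤ) (t : ZMod p) :
    phase ω ((z : ZMod p) * t) = phase ω t ^ z := by
  have hn : ∀ l : ℕ, phase ω ((l : ZMod p) * t) = phase ω t ^ l := by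
    intro l
    induction l with
    | zero => simp
    | succ l ih => rw [Nat.cast_succ, add_mul, phase_add hω, ih, one_mul, pow_succ]
  obtain ⟨l, rfl | rfl⟩ := z.eq_nat_or_neg
  · rw [Int.cast_natCast, hn, zpow_natCast]
  · rw [Int.cast_neg, Int.cast_natCast, neg_mul, phase_neg hω, hn, zpow_neg, zpow_natCast]

/-- The amplitudes of a graph state, split into the contributions of the three blocks of `Γ`. -/
lemma graphState_apply (hω : IsPrimitiveRoot ω p) {χ : F → F → Circle} {β : F → F → ZMod p}
    (hβ : ∀ h g, (χ h g : ℂ) = phase ω (β h g)) (Γ : Matrix (Fin (k + n)) (Fin (k + n)) ℤ)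
    (x : Fin k → F) (y : Fin n → F) :
    graphState χ Γ x y = ((Real.sqrt ((Fintype.card F : ℝ) ^ n))⁻¹ : ℂ) *
      phase ω (∑ i, ∑ j ∈ Finset.Ioi i,
        (Γ (Fin.castAdd n i) (Fin.castAdd n j) : ZMod p) * β (x i) (x j)) *
      (phase ω (∑ i, ∑ j ∈ Finset.Ioi i, blockMy p Γ i j * β (y i) (y j)) *
        phase ω (∑ i, ∑ j, blockB p Γ i j * β (x i) (y j))) := by
  have h : ((∏ i : Fin (k + n), ∏ j ∈ Finset.Ioi i,
      χ (Fin.append x y i) (Fin.append x y j) ^ Γ i j : Circle) : ℂ) =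
      phase ω (∑ i : Fin (k + n), ∑ j ∈ Finset.Ioi i,
        (Γ i j : ZMod p) * β (Fin.append x y i) (Fin.append x y j)) := by
    refine (map_prod Circle.coeHom _ _).trans ?_
    rw [phase_sum hω]
    refine Finset.prod_congr rfl fun i _ => (map_prod Circle.coeHom _ _).trans ?_
    rw [phase_sum hω]
    refine Finset.prod_congr rfl fun j _ => ?_
    rw [phase_intCast_mul hω, ← hβ]
    exact Circle.coe_zpow _ _
  rw [graphState, h, sum_Ioi_add, phase_add hω, phase_add hω]
  simp only [Fin.append_left, Fin.append_right, blockMy, blockB, Matrix.of_apply]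
  ring

/-- The values are `p`-th roots of unity because `p` annihilates `F`. Their exponents are
biadditive, hence bilinear over the prime field, and `M` is the Gram matrix. -/
lemma exists_matrix_of_bicharacter (hω : IsPrimitiveRoot ω p) (b : Module.Basis (Fin m) (ZMod p) F)
    {χ : F → F → Circle} (hχ : IsNondegSymmBicharacter χ) :
    ∃ M : Matrix (Fin m) (Fin m) (ZMod p), M.IsSymm ∧
      (∀ h g : F, (χ h g : ℂ) = phase ω (b.equivFun h ⬝ᵥ M *ᵥ b.equivFun g)) ∧
      ∀ x : Fin m → ZMod p, M *ᵥ x = 0 → x = 0 := by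
  have h0 : ∀ h, χ h 0 = 1 := fun h => by
    have := hχ.map_add h 0 0
    rwa [add_zero, eq_comm, mul_eq_left] at this
  have hmul : ∀ h g (l : ℕ), χ h (l • g) = χ h g ^ l := by
    intro h g l
    induction l with
    | zero => rw [zero_smul, pow_zero, h0]
    | succ l ih => rw [succ_nsmul, hχ.map_add, ih, pow_succ]
  have hpow : ∀ h g, (χ h g : ℂ) ^ p = 1 := by
    intro h g
    rw [← Circle.coe_pow, ← hmul, ← Nat.cast_smul_eq_nsmul (ZMod p), CharP.cast_eq_zero, zero_smul,
      h0, Circle.coe_one]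
  choose β hβ using fun h g => exists_phase_eq hω (hpow h g)
  have hadd : ∀ h g g', β h (g + g') = β h g + β h g' := by
    intro h g g'
    apply phase_injective hω
    rw [phase_add hω, ← hβ, ← hβ, ← hβ, hχ.map_add, Circle.coe_mul]
  have hsymm : ∀ h g, β h g = β g h := by
    intro h g
    apply phase_injective hω
    rw [← hβ, ← hβ, hχ.symm]
  have hsmul : ∀ (c : ZMod p) h g, β h (c • g) = c • β h g := fun c h g =>
    ZMod.map_smul (AddMonoidHom.mk' (β h) (hadd h)) c g
  let L : F →ₗ[ZMod p] F →ₗ[ZMod p] ZMod p := LinearMap.mk₂ (ZMod p) β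
    (fun h h' g => by rw [hsymm, hadd, hsymm g, hsymm g]) (fun c h g => by rw [hsymm, hsmul, hsymm])
    hadd hsmul
  have hL : ∀ h g, β h g = b.equivFun h ⬝ᵥ LinearMap.toMatrix₂ b b L *ᵥ b.equivFun g := fun h g =>
    apply_eq_dotProduct_toMatrix₂_mulVec b b L h g
  refine ⟨LinearMap.toMatrix₂ b b L, ?_, fun h g => by rw [← hL, hβ], fun x hx => ?_⟩
  · ext i j
    rw [Matrix.transpose_apply, LinearMap.toMatrix₂_apply, LinearMap.toMatrix₂_apply]
    exact hsymm _ _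
  · have h1 : b.equivFun.symm x = 0 := by
      apply hχ.nondegenerate
      intro g
      apply Subtype.ext
      change (χ _ g : ℂ) = 1
      rw [hχ.symm, hβ, hL, LinearEquiv.apply_symm_apply, hx, dotProduct_zero, phase_zero]
    exact b.equivFun.symm.map_eq_zero_iff.1 h1

lemma kron_apply {R : Type*} [Mul R] (A : Matrix (Fin k) (Fin n) R)
    (M : Matrix (Fin m) (Fin m) R) (i : Fin k) (s : Fin m) (j : Fin n) (t : Fin m) :
    kron A M (finProdFinEquiv (i, s)) (finProdFinEquiv (j, t)) = A i j * M s t := by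
  simp [kron, Matrix.kroneckerMap_apply]

lemma sum_fin_mul {M : Type*} [AddCommMonoid M] (f : Fin (n * m) → M) :
    ∑ l, f l = ∑ i : Fin n, ∑ s : Fin m, f (finProdFinEquiv (i, s)) := by
  rw [← finProdFinEquiv.sum_comp, Fintype.sum_prod_type]

lemma dotProduct_kron_mulVec (b : Module.Basis (Fin m) (ZMod p) F)
    (A : Matrix (Fin k) (Fin n) (ZMod p)) (M : Matrix (Fin m) (Fin m) (ZMod p)) (x : Fin k → F)
    (y : Fin n → F) :
    coords b k x ⬝ᵥ kron A M *ᵥ coords b n y =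
      ∑ i, ∑ j, A i j * (b.equivFun (x i) ⬝ᵥ M *ᵥ b.equivFun (y j)) := by
  simp only [dotProduct, Matrix.mulVec, sum_fin_mul, coords_apply, kron_apply, Finset.mul_sum]
  refine Finset.sum_congr rfl fun i _ => ?_
  rw [Finset.sum_comm]
  refine Finset.sum_congr rfl fun j _ => Finset.sum_congr rfl fun s _ =>
    Finset.sum_congr rfl fun t _ => ?_
  ring

lemma finProdFinEquiv_lt_iff {i j : Fin n} (hij : i ≠ j) (s t : Fin m) :
    (finProdFinEquiv (i, s) < finProdFinEquiv (j, t)) ↔ i < j := by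
  have key : ∀ {i j : Fin n} (s t : Fin m), i < j →
      finProdFinEquiv (i, s) < finProdFinEquiv (j, t) := by
    intro i j s t h
    rw [Fin.lt_def, finProdFinEquiv_apply_val, finProdFinEquiv_apply_val]
    have h1 : m * ((i : ℕ) + 1) ≤ m * (j : ℕ) := Nat.mul_le_mul_left m h
    have h2 := s.isLt
    rw [mul_add, mul_one] at h1
    change (s : ℕ) + m * (i : ℕ) < (t : ℕ) + m * (j : ℕ)
    omega
  refine ⟨fun h => ?_, key s t⟩
  by_contra h'
  exact (key t s (lt_of_le_of_ne (not_lt.1 h') (Ne.symm hij))).not_gt h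

/-- In lexicographic order two indices from different blocks compare as their blocks do, and pairs
within one block contribute nothing because `A` has zero diagonal. -/
lemma quadForm_kron (b : Module.Basis (Fin m) (ZMod p) F)
    {A : Matrix (Fin n) (Fin n) (ZMod p)} (hA : ∀ i, A i i = 0)
    (M : Matrix (Fin m) (Fin m) (ZMod p)) (y : Fin n → F) :
    quadForm (kron A M) (coords b n y) =
      ∑ i, ∑ j ∈ Finset.Ioi i, A i j * (b.equivFun (y i) ⬝ᵥ M *ᵥ b.equivFun (y j)) := by
  simp only [quadForm, sum_Ioi_eq_sum_ite, sum_fin_mul, coords_apply, kron_apply]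
  refine Finset.sum_congr rfl fun i _ => ?_
  rw [Finset.sum_comm]
  refine Finset.sum_congr rfl fun j _ => ?_
  by_cases hij : i = j
  · subst hij
    simp [hA]
  · simp only [finProdFinEquiv_lt_iff hij]
    split_ifs with h
    · simp only [dotProduct, Matrix.mulVec, Finset.mul_sum]
      refine Finset.sum_congr rfl fun s _ => Finset.sum_congr rfl fun t _ => ?_
      ring
    · simp

/-- Since `M` is injective, `x (A ⊗ M)` vanishes exactly when each of the `m` slices of `x` lies in
the left kernel of `A`. -/
lemma rank_blockB_iff {A : Matrix (Fin k) (Fin n) (ZMod p)} {M : Matrix (Fin m) (Fin m) (ZMod p)}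
    (hm : 0 < m) (hs : M.IsSymm) (hM : ∀ x : Fin m → ZMod p, M *ᵥ x = 0 → x = 0) :
    A.rank = k ↔ ∀ x, x ᵥ* kron A M = 0 → x = 0 := by
  have h1 : A.rank = k ↔ ∀ x, x ᵥ* A = 0 → x = 0 := by
    have h2 : (∀ x, x ᵥ* A = 0 → x = 0) ↔ LinearIndependent (ZMod p) A.row := by
      rw [← Matrix.vecMul_injective_iff]
      exact (injective_iff_map_eq_zero A.vecMulLinear).symm
    rw [h2, linearIndependent_iff_card_eq_finrank_span, Fintype.card_fin, Set.finrank,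
      ← Matrix.rank_eq_finrank_span_row, eq_comm]
  have h3 : ∀ (x : Fin (k * m) → ZMod p) (j : Fin n) (t : Fin m),
      (x ᵥ* kron A M) (finProdFinEquiv (j, t)) =
        (M *ᵥ fun s => ((fun i => x (finProdFinEquiv (i, s))) ᵥ* A) j) t := by
    intro x j t
    simp only [Matrix.vecMul, Matrix.mulVec, dotProduct, sum_fin_mul, kron_apply, Finset.mul_sum]
    rw [Finset.sum_comm]
    refine Finset.sum_congr rfl fun s _ => Finset.sum_congr rfl fun i _ => ?_
    rw [hs.apply]
    ring
  rw [h1]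
  constructor
  · intro h x hx
    have h4 : ∀ s, (fun i => x (finProdFinEquiv (i, s))) = 0 := by
      intro s
      apply h
      ext j
      have h5 := hM (fun s => ((fun i => x (finProdFinEquiv (i, s))) ᵥ* A) j) (by
        ext t
        rw [← h3, hx]
        rfl)
      exact congrFun h5 s
    ext l
    obtain ⟨⟨i, s⟩, rfl⟩ := finProdFinEquiv.surjective l
    exact congrFun (h4 s) i
  · intro h x hx
    -- All slices are taken equal to `x`; since `m` is positive, `x` can be recovered from slice
    -- `0`.
    have h4 := h (fun l => x (finProdFinEquiv.symm l).1) (by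
      ext l
      obtain ⟨⟨j, t⟩, rfl⟩ := finProdFinEquiv.surjective l
      rw [h3]
      simp only [Equiv.symm_apply_apply, hx]
      exact congrFun (Matrix.mulVec_zero M) t)
    ext i
    have h5 := congrFun h4 (finProdFinEquiv (i, ⟨0, hm⟩))
    simpa using h5

/-- In coordinates, graph states over `F` are graph states over the prime field. -/
lemma exists_toPrime_graphState (hω : IsPrimitiveRoot ω p) (b : Module.Basis (Fin m) (ZMod p) F)
    {χ : F → F → Circle} {M : Matrix (Fin m) (Fin m) (ZMod p)}
    (hM : ∀ h g : F, (χ h g : ℂ) = phase ω (b.equivFun h ⬝ᵥ M *ᵥ b.equivFun g))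
    {Γ : Matrix (Fin (k + n)) (Fin (k + n)) ℤ} (hΓ : IsWeightedAdjacency Γ) :
    ∃ g : (Fin (k * m) → ZMod p) → ℂ, (∀ x, ‖g x‖ ^ 2 * (p : ℝ) ^ (n * m) = 1) ∧
      ∀ x, toPrime b n (graphState χ Γ x) =
        inputState ω (kron (blockMy p Γ) M) (kron (blockB p Γ) M) g (coords b k x) := by
  refine ⟨fun x => ((Real.sqrt ((Fintype.card F : ℝ) ^ n))⁻¹ : ℂ) *
    phase ω (∑ i, ∑ j ∈ Finset.Ioi i, (Γ (Fin.castAdd n i) (Fin.castAdd n j) : ZMod p) *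
      (b.equivFun ((coords b k).symm x i) ⬝ᵥ M *ᵥ b.equivFun ((coords b k).symm x j))), ?_, ?_⟩
  · intro x
    have hcard : (Fintype.card F : ℝ) ^ n = (p : ℝ) ^ (n * m) := by
      rw [Module.card_fintype b, ZMod.card, Fintype.card_fin, Nat.cast_pow, ← pow_mul, mul_comm]
    have hp : (0 : ℝ) < (p : ℝ) ^ (n * m) := pow_pos (Nat.cast_pos.2 (NeZero.pos p)) _
    rw [norm_mul, norm_phase hω, mul_one, hcard, norm_inv, Complex.norm_real, inv_pow,
      Real.norm_of_nonneg (Real.sqrt_nonneg _), Real.sq_sqrt hp.le, inv_mul_cancel₀ hp.ne']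
  · intro x
    ext y
    obtain ⟨y, rfl⟩ := (coords b n).surjective y
    have h1 : toPrime b n (graphState χ Γ x) (coords b n y) = graphState χ Γ x y := by
      simp [toPrime, LinearMap.funLeft_apply]
    rw [h1, graphState_apply hω hM, inputState, graphFun, dotProduct_kron_mulVec, quadForm_kron b]
    · simp only [Equiv.symm_apply_apply]
    · intro i
      simp [blockMy, hΓ.loopless]

end GraphState

/-! ### Every error-closed code over the prime field is locally equivalent to a graphical code. -/

section PrimeField

variable {p : ℕ} [Fact p.Prime] {N : ℕ} {ω : ℂ}

/-- An error-closed code whose errors lie in the graph of `C` is locally equivalent to a graph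
code. -/
lemma exists_locallyEquivalent_graphCode (hω : IsPrimitiveRoot ω p)
    {Q : Submodule ℂ ((Fin N → ZMod p) → ℂ)} (hQ : Q ≠ ⊥) (hcl : ErrorClosed p ω Q)
    {C : Matrix (Fin N) (Fin N) (ZMod p)} (hC : C.IsSymm) (h0 : ∀ i, C i i = 0)
    (herr : ∀ a d, (a, d) ∈ errSpace hω Q → d = C *ᵥ a) :
    ∃ W, LocallyEquivalent p ω Q (graphCode ω C W) := by
  let W : Submodule (ZMod p) (Fin N → ZMod p) := (errSpace hω Q).map (LinearMap.fst _ _ _)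
  have hW : ∀ a ∈ W, (a, C *ᵥ a) ∈ errSpace hω Q := by
    rintro _ ⟨⟨a, d⟩, h, rfl⟩
    have h1 := herr a d h
    rw [h1] at h
    exact h
  -- The scalar `μ a` is the eigenvalue of the normalized error, a conjugated shift, so `μ` is a
  -- genuine character of `W`.
  have hμ : ∀ a : W, ∃ c : ℂ, ∀ v ∈ Q, ∀ y,
      graphFun ω C y / graphFun ω C (y - a) * v (y - a) = c * v y := by
    rintro ⟨a, ha⟩
    obtain ⟨c, hc⟩ := hW a ha
    refine ⟨phase ω (quadForm C a) * c, fun v hv y => ?_⟩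
    rw [← errOp_mulVec_graph hω hC h0, hc v hv, Pi.smul_apply, smul_eq_mul, mul_assoc]
  choose μ hμ using hμ
  obtain ⟨v₀, hv₀, hne⟩ := Q.ne_bot_iff.1 hQ
  obtain ⟨y₀, hy₀⟩ := Function.ne_iff.1 hne
  have hadd : ∀ a a' : W, μ (a + a') = μ a * μ a' := by
    intro a a'
    refine mul_right_cancel₀ hy₀ ?_
    have h1 := hμ (a + a') v₀ hv₀ y₀
    have h2 := hμ a v₀ hv₀ y₀
    have h3 := hμ a' v₀ hv₀ (y₀ - a)
    have e : y₀ - (a : Fin N → ZMod p) - a' = y₀ - (a + a' : W) := by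
      rw [Submodule.coe_add, sub_sub]
    rw [e] at h3
    rw [← h1, mul_right_comm, ← h2, mul_assoc, mul_comm _ (μ a'), ← h3, ← mul_assoc,
      div_mul_div_cancel₀ (graphFun_ne_zero hω C _)]
  have hzero : μ 0 = 1 := by
    refine mul_right_cancel₀ hy₀ ?_
    rw [← hμ 0 v₀ hv₀ y₀, Submodule.coe_zero, sub_zero, div_self (graphFun_ne_zero hω C _)]
  have hpow : ∀ a, μ a ^ p = 1 := by
    intro a
    have h1 : ∀ l : ℕ, μ (l • a) = μ a ^ l := by
      intro l
      induction l with
      | zero => rw [zero_smul, hzero, pow_zero]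
      | succ l ih => rw [succ_nsmul, hadd, ih, pow_succ]
    rw [← h1, ← Nat.cast_smul_eq_nsmul (ZMod p), CharP.cast_eq_zero, zero_smul, hzero]
  choose l hl using fun a => exists_phase_eq hω (hpow a)
  let f : W →ₗ[ZMod p] ZMod p := AddMonoidHom.toZModLinearMap p (AddMonoidHom.mk' l fun a a' => by
    apply phase_injective hω
    rw [phase_add hω, ← hl, ← hl, ← hl, hadd])
  -- The exponent of `μ` extends from `W` to the whole space, so `μ a` equals `ω` to the power `e ⬝ᵥ
  -- a`; multiplication by that phase in `y` will cancel `μ`.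
  obtain ⟨f', hf'⟩ := f.exists_extend
  let e : Fin N → ZMod p := fun i => f' (Pi.single i 1)
  have he : ∀ a, f' a = e ⬝ᵥ a := by
    intro a
    rw [LinearMap.pi_apply_eq_sum_univ f' a]
    simp only [dotProduct, smul_eq_mul, e]
    refine Finset.sum_congr rfl fun i _ => ?_
    rw [mul_comm]
    congr 2
    ext j
    simp [Pi.single_apply, eq_comm]
  have hμe : ∀ a : W, μ a = phase ω (e ⬝ᵥ a) := by
    intro a
    rw [hl, ← he]
    congr 1
    exact (LinearMap.congr_fun hf' a).symm
  let θ : Fin N → ZMod p → ℂ := fun i t => phase ω (e i * t)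
  have hθ : ∀ i v a, θ i (v + a) = θ i v * θ i a * phase ω ((0 : Fin N → ZMod p) i * a * v) := by
    intro i v a
    simp [θ, mul_add, phase_add hω]
  have hT : ∀ v y, (monomialOp 1 (fun i => Matrix.diagonal (θ i)) *ᵥ v) y =
      phase ω (e ⬝ᵥ y) * v y := by
    intro v y
    rw [monomialOp_diagonal_mulVec]
    simp only [θ, dotProduct, phase_sum hω]
  -- The converse direction is where error-closedness enters.
  have hcode : ∀ v, v ∈ Q ↔ ∀ a : W, ∀ y,
      graphFun ω C y / graphFun ω C (y - a) * v (y - a) = μ a * v y := by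
    refine fun v => ⟨fun hv a y => hμ a v hv y, fun hv => hcl v fun a d c hc => ?_⟩
    have h1 : (a, d) ∈ errSpace hω Q := ⟨c, hc⟩
    have h2 := herr a d h1
    subst h2
    have ha : a ∈ W := ⟨_, h1, rfl⟩
    have h3 : phase ω (quadForm C a) * c = μ ⟨a, ha⟩ := by
      refine mul_right_cancel₀ hy₀ ?_
      rw [← hμ ⟨a, ha⟩ v₀ hv₀ y₀, ← errOp_mulVec_graph hω hC h0, hc v₀ hv₀, Pi.smul_apply,
        smul_eq_mul, mul_assoc]
    ext y
    refine mul_left_cancel₀ (phase_ne_zero hω (quadForm C a)) ?_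
    rw [errOp_mulVec_graph hω hC h0, hv ⟨a, ha⟩ y, Pi.smul_apply, smul_eq_mul, ← mul_assoc, h3]
  refine ⟨W, ?_⟩
  have key := locallyEquivalent_diagonal hω Q (θ := θ) (s := 0) (fun i v => norm_phase hω _) hθ
  convert key using 1
  ext v
  rw [mem_graphCode]
  constructor
  · intro hv
    refine ⟨fun y => (phase ω (e ⬝ᵥ y))⁻¹ * v y, (hcode _).2 fun a y => ?_, ?_⟩
    · have h1 := hv a a.2 y
      rw [hμe, dotProduct_sub, phase_sub hω]
      have n1 := phase_ne_zero hω (e ⬝ᵥ y)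
      have n2 := phase_ne_zero hω (e ⬝ᵥ (a : Fin N → ZMod p))
      have n3 := graphFun_ne_zero hω C (y - a)
      field_simp
      linear_combination h1
    · ext y
      rw [Matrix.mulVecLin_apply, hT, mul_inv_cancel_left₀ (phase_ne_zero hω _)]
  · rintro ⟨w, hw, rfl⟩ a ha y
    have h1 := (hcode w).1 hw ⟨a, ha⟩ y
    rw [hμe] at h1
    rw [Matrix.mulVecLin_apply, hT, hT, dotProduct_sub, phase_sub hω]
    have n1 := phase_ne_zero hω (e ⬝ᵥ y)
    have n2 := phase_ne_zero hω (e ⬝ᵥ a)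
    have n3 := graphFun_ne_zero hω C (y - a)
    simp only at h1
    field_simp at h1 ⊢
    linear_combination h1

/-- The matrix is the quotient map modulo `W` in coordinates; its surjectivity makes the rows
independent. -/
lemma exists_matrix_ker_eq {K : Type*} [Field K] (W : Submodule K (Fin N → K)) :
    ∃ (k : ℕ) (B : Matrix (Fin k) (Fin N) K), LinearMap.ker B.mulVecLin = W ∧
      ∀ x, x ᵥ* B = 0 → x = 0 := by
  let φ := (Module.finBasis K ((Fin N → K) ⧸ W)).equivFun
  let f : (Fin N → K) →ₗ[K] _ := φ.toLinearMap ∘ₗ W.mkQ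
  refine ⟨_, LinearMap.toMatrix' f, ?_, fun x hx => ?_⟩
  · ext v
    rw [LinearMap.mem_ker, Matrix.mulVecLin_apply, LinearMap.toMatrix'_mulVec]
    simp [f]
  · ext i
    obtain ⟨y, hy⟩ : ∃ y, f y = Pi.single i 1 :=
      (φ.surjective.comp W.mkQ_surjective) (Pi.single i 1)
    have h1 : x ⬝ᵥ LinearMap.toMatrix' f *ᵥ y = 0 := by
      rw [Matrix.dotProduct_mulVec, hx, zero_dotProduct]
    rw [LinearMap.toMatrix'_mulVec, hy] at h1
    simpa using h1

/-- Edges between inputs only change the phase of each state, so that block is set to `0`; the other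
weights are lifted to integers in `[0, p)`. -/
lemma exists_weightedAdjacency {k : ℕ} (B : Matrix (Fin k) (Fin N) (ZMod p))
    {C : Matrix (Fin N) (Fin N) (ZMod p)} (hC : C.IsSymm) (h0 : ∀ i, C i i = 0) :
    ∃ Γ : Matrix (Fin (k + N)) (Fin (k + N)) ℤ, IsWeightedAdjacency Γ ∧ blockB p Γ = B ∧
      blockMy p Γ = C := by
  let D : Matrix (Fin k ⊕ Fin N) (Fin k ⊕ Fin N) (ZMod p) := Matrix.fromBlocks 0 B Bᵀ C
  have hD : ∀ i j, D i j = D j i := by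
    rintro (i | i) (j | j)
    · rfl
    · rfl
    · rfl
    · exact (hC.apply i j).symm
  refine ⟨Matrix.of fun i j => ((D (finSumFinEquiv.symm i) (finSumFinEquiv.symm j)).val : ℤ),
    ⟨?_, ?_⟩, ?_, ?_⟩
  · ext i j
    simp only [Matrix.transpose_apply, Matrix.of_apply, hD (finSumFinEquiv.symm j)]
  · intro i
    obtain ⟨i | i, rfl⟩ := finSumFinEquiv.surjective i <;> simp [D, h0]
  · ext i j
    simp [blockB, D]
  · ext i j
    simp [blockMy, D]

lemma isGraphicalCode_graphCode (hω : IsPrimitiveRoot ω p) {C : Matrix (Fin N) (Fin N) (ZMod p)}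
    (hC : C.IsSymm) (h0 : ∀ i, C i i = 0) (W : Submodule (ZMod p) (Fin N → ZMod p)) :
    ∃ k, IsGraphicalCode k (graphCode ω C W) := by
  obtain ⟨k, B, rfl, hB⟩ := exists_matrix_ker_eq W
  obtain ⟨Γ, hΓ, hΓB, hΓC⟩ := exists_weightedAdjacency B hC h0
  let χ : ZMod p → ZMod p → Circle := fun h g =>
    ⟨phase ω (h * g), mem_sphere_zero_iff_norm.2 (norm_phase hω _)⟩
  have hχ : ∀ h g, (χ h g : ℂ) = phase ω (h * g) := fun h g => rfl
  let g : (Fin k → ZMod p) → ℂ := fun x =>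
    ((Real.sqrt ((Fintype.card (ZMod p) : ℝ) ^ N))⁻¹ : ℂ) * phase ω (∑ i, ∑ j ∈ Finset.Ioi i,
      (Γ (Fin.castAdd N i) (Fin.castAdd N j) : ZMod p) * (x i * x j))
  have hp : (0 : ℝ) < (p : ℝ) ^ N := pow_pos (Nat.cast_pos.2 (NeZero.pos p)) _
  have hg : ∀ x, ‖g x‖ ^ 2 * (p : ℝ) ^ N = 1 := by
    intro x
    simp only [g]
    rw [norm_mul, norm_phase hω, mul_one, ZMod.card, norm_inv, Complex.norm_real, inv_pow,
      Real.norm_of_nonneg (Real.sqrt_nonneg _), Real.sq_sqrt hp.le, inv_mul_cancel₀ hp.ne']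
  have hstate : graphState χ Γ = inputState ω C B g := by
    ext x y
    rw [graphState_apply hω hχ, inputState, hΓB, hΓC, graphFun]
    congr 3
    · simp only [quadForm, mul_assoc]
    · simp only [dotProduct, Matrix.mulVec, Finset.mul_sum]
      refine Finset.sum_congr rfl fun i _ => Finset.sum_congr rfl fun j _ => ?_
      ring
  have hspan : graphSpan χ Γ = graphCode ω C (LinearMap.ker B.mulVecLin) := by
    rw [graphSpan, hstate, span_inputState hω]
    intro x hx
    have := hg x
    simp [hx] at this
  refine ⟨k, χ, Γ, ⟨?_, ?_, ?_⟩, hΓ, hspan.symm, ?_⟩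
  · intro h g g'
    apply Subtype.ext
    change phase ω _ = phase ω _ * phase ω _
    rw [mul_add, phase_add hω]
  · intro h g
    apply Subtype.ext
    change phase ω _ = phase ω _
    rw [mul_comm]
  · intro h hh
    have h1 : phase ω (h * 1) = 1 := congrArg Subtype.val (hh 1)
    rwa [phase_eq_one_iff hω, mul_one] at h1
  · have h1 := (orthonormal_inputState hω C hg hB).linearIndependent
    have h2 : LinearIndependent ℂ (inputState ω C B g) :=
      LinearIndependent.of_comp (WithLp.linearEquiv 2 ℂ _).symm.toLinearMap h1
    rw [← hspan, graphSpan, hstate, finrank_span_eq_card h2, Fintype.card_pi_const]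

lemma exists_locallyEquivalent_isGraphicalCode (hω : IsPrimitiveRoot ω p)
    {Q : Submodule ℂ ((Fin N → ZMod p) → ℂ)} (hQ : Q ≠ ⊥) (hcl : ErrorClosed p ω Q) :
    ∃ k Q', IsGraphicalCode k Q' ∧ LocallyEquivalent p ω Q Q' := by
  obtain ⟨Q₁, C, h1, hC, h0, herr⟩ := exists_locallyEquivalent_graph hω hQ
  obtain ⟨W, h2⟩ := exists_locallyEquivalent_graphCode hω (h1.ne_bot hQ) (h1.errorClosed hω hcl)
    hC h0 herr
  obtain ⟨k, hk⟩ := isGraphicalCode_graphCode hω hC h0 W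
  exact ⟨k, _, hk, h1.trans h2⟩

end PrimeField

/-! ### The span of graph states over `F` as a graph code. -/

section Extension

variable {p : ℕ} [Fact p.Prime] {F : Type*} [Field F] [Fintype F] [DecidableEq F]
  [Algebra (ZMod p) F] {k n m : ℕ} {ω : ℂ}

lemma kron_isSymm {A : Matrix (Fin n) (Fin n) (ZMod p)} {M : Matrix (Fin m) (Fin m) (ZMod p)}
    (hA : A.IsSymm) (hM : M.IsSymm) : (kron A M).IsSymm := by
  ext l l'
  obtain ⟨⟨i, s⟩, rfl⟩ := finProdFinEquiv.surjective l
  obtain ⟨⟨j, t⟩, rfl⟩ := finProdFinEquiv.surjective l'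
  rw [Matrix.transpose_apply, kron_apply, kron_apply, hA.apply, hM.apply]

lemma map_toPrime_graphSpan (hω : IsPrimitiveRoot ω p) (b : Module.Basis (Fin m) (ZMod p) F)
    {χ : F → F → Circle} {M : Matrix (Fin m) (Fin m) (ZMod p)}
    (hM : ∀ h g : F, (χ h g : ℂ) = phase ω (b.equivFun h ⬝ᵥ M *ᵥ b.equivFun g))
    {Γ : Matrix (Fin (k + n)) (Fin (k + n)) ℤ} (hΓ : IsWeightedAdjacency Γ) :
    (graphSpan χ Γ).map (toPrime b n).toLinearMap =
      graphCode ω (kron (blockMy p Γ) M) (LinearMap.ker (kron (blockB p Γ) M).mulVecLin) := by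
  obtain ⟨g, hg, hst⟩ := exists_toPrime_graphState hω b hM hΓ
  rw [graphSpan, Submodule.map_span, ← Set.range_comp, ← span_inputState hω (g := g)]
  · congr 1
    have h : (toPrime b n).toLinearMap ∘ graphState χ Γ =
        inputState ω (kron (blockMy p Γ) M) (kron (blockB p Γ) M) g ∘ coords b k := funext hst
    rw [h, (coords b k).surjective.range_comp]
  · intro x hx
    have := hg x
    simp [hx] at this

lemma graphState_tfae (hω : IsPrimitiveRoot ω p) (b : Module.Basis (Fin m) (ZMod p) F)
    {χ : F → F → Circle} {M : Matrix (Fin m) (Fin m) (ZMod p)} (hs : M.IsSymm)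
    (hM : ∀ h g : F, (χ h g : ℂ) = phase ω (b.equivFun h ⬝ᵥ M *ᵥ b.equivFun g))
    (hnd : ∀ x : Fin m → ZMod p, M *ᵥ x = 0 → x = 0)
    {Γ : Matrix (Fin (k + n)) (Fin (k + n)) ℤ} (hΓ : IsWeightedAdjacency Γ) :
    List.TFAE [
      Orthonormal ℂ (fun x : Fin k → F => WithLp.toLp 2 (graphState χ Γ x)),
      (blockB p Γ).rank = k,
      Module.finrank ℂ (graphSpan χ Γ) = Fintype.card F ^ k] := by
  obtain ⟨g, hg, hst⟩ := exists_toPrime_graphState hω b hM hΓ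
  have hm : 0 < m := by
    rw [Nat.pos_iff_ne_zero]
    rintro rfl
    have := b.index_nonempty
    exact this.elim fun i => i.elim0
  have hcard : Fintype.card (Fin k → F) = Fintype.card F ^ k := by simp
  tfae_have 1 → 3 := by
    intro h
    have h2 : LinearIndependent ℂ (graphState χ Γ) :=
      LinearIndependent.of_comp (WithLp.linearEquiv 2 ℂ _).symm.toLinearMap h.linearIndependent
    rw [graphSpan, finrank_span_eq_card h2, hcard]
  tfae_have 3 → 2 := by
    intro h
    -- The number of spanning vectors equals the dimension of their span.
    have h1 : LinearIndependent ℂ (graphState χ Γ) := by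
      rw [linearIndependent_iff_card_eq_finrank_span, hcard, ← h]
      rfl
    have h2 := h1.map' (toPrime b n).toLinearMap (toPrime b n).ker
    have h3 : (toPrime b n).toLinearMap ∘ graphState χ Γ =
        inputState ω (kron (blockMy p Γ) M) (kron (blockB p Γ) M) g ∘ coords b k := funext hst
    rw [h3, linearIndependent_equiv] at h2
    rw [rank_blockB_iff hm hs hnd]
    refine fun x hx => eq_zero_of_linearIndependent_inputState (fun x hx => ?_) h2 hx
    have := hg x
    simp [hx] at this
  tfae_have 2 → 1 := by
    intro h
    rw [rank_blockB_iff hm hs hnd] at h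
    have h1 := orthonormal_inputState hω (kron (blockMy p Γ) M) hg h
    rw [orthonormal_iff_ite] at h1 ⊢
    intro x x'
    have h2 := h1 (coords b k x) (coords b k x')
    simp only [(coords b k).injective.eq_iff] at h2
    rw [← h2, ← hst, ← hst, EuclideanSpace.inner_toLp_toLp, EuclideanSpace.inner_toLp_toLp,
      dotProduct, dotProduct, ← (coords b n).sum_comp]
    simp [toPrime, LinearMap.funLeft_apply]
  tfae_finish

end Extension

end QCode

end

/-! ### The main theorem. -/

open QCode in
theorem mainTheorem1 (p : ℕ) [Fact p.Prime] (m : ℕ) (F : Type*) [Field F] [Fintype F]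
    [DecidableEq F] [Algebra (ZMod p) F] (b : Module.Basis (Fin m) (ZMod p) F)
    (ω : ℂ) (hω : IsPrimitiveRoot ω p) (n : ℕ) :
    (∀ Q : Submodule ℂ ((Fin n → F) → ℂ), IsStabilizerCode p ω Q →
      ∃ (k : ℕ) (Q' : Submodule ℂ ((Fin n → F) → ℂ)),
        IsGraphicalCode k (Q'.map (toPrime b n).toLinearMap) ∧
        CodeEquivalent p ω (Q.map (toPrime b n).toLinearMap) (Q'.map (toPrime b n).toLinearMap) ∧
        CodeEquivalent p ω Q Q') ∧
    (∀ (k : ℕ) (χ : F → F → Circle) (Γ : Matrix (Fin (k + n)) (Fin (k + n)) ℤ),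
      IsNondegSymmBicharacter χ → IsWeightedAdjacency Γ →
        List.TFAE [
          Orthonormal ℂ (fun x : Fin k → F => WithLp.toLp 2 (graphState χ Γ x)),
          (blockB p Γ).rank = k,
          Module.finrank ℂ (graphSpan χ Γ) = Fintype.card F ^ k] ∧
        IsStabilizerCode p ω (graphSpan χ Γ) ∧
        ∃ M : Matrix (Fin m) (Fin m) (ZMod p), M.IsSymm ∧
          (∀ h g : F, (χ h g : ℂ) = ω ^ (b.equivFun h ⬝ᵥ M *ᵥ b.equivFun g).val) ∧
          stabilizerOf p ω ((graphSpan χ Γ).map (toPrime b n).toLinearMap) =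
            {g : (Matrix (Fin (n * m) → ZMod p) (Fin (n * m) → ZMod p) ℂ)ˣ |
              ∃ a : Fin (n * m) → ZMod p, kron (blockB p Γ) M *ᵥ a = 0 ∧
                (g : Matrix (Fin (n * m) → ZMod p) (Fin (n * m) → ZMod p) ℂ) =
                  ω ^ (quadForm (kron (blockMy p Γ) M) a).val •
                    (opX a * opZ p ω (a ᵥ* kron (blockMy p Γ) M))} ∧
          ∀ v, v ∈ (graphSpan χ Γ).map (toPrime b n).toLinearMap ↔
            ∀ g ∈ stabilizerOf p ω ((graphSpan χ Γ).map (toPrime b n).toLinearMap),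
              (g : Matrix (Fin (n * m) → ZMod p) (Fin (n * m) → ZMod p) ℂ) *ᵥ v = v) := by
  constructor
  · intro Q hQ
    have hcl := (errorClosed_map_toPrime_iff b n).2 (hQ.errorClosed hω)
    have hne : Q.map (toPrime b n).toLinearMap ≠ ⊥ := fun h =>
      hQ.1 (Submodule.map_injective_of_injective (toPrime b n).injective
        (h.trans (Submodule.map_bot _).symm))
    obtain ⟨k, Q', hk, hloc⟩ := exists_locallyEquivalent_isGraphicalCode hω hne hcl
    -- The graphical code over the prime field is pulled back to `F`, so that local equivalence can
    -- be read in both alphabets.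
    have hQ' : (Q'.map (toPrime b n).symm.toLinearMap).map (toPrime b n).toLinearMap = Q' := by
      rw [← Submodule.map_comp, LinearEquiv.comp_coe, LinearEquiv.symm_trans_self,
        LinearEquiv.refl_toLinearMap, Submodule.map_id]
    rw [← hQ'] at hk hloc
    exact ⟨k, _, hk, hloc.codeEquivalent, (hloc.of_map_toPrime b n).codeEquivalent⟩
  · intro k χ Γ hχ hΓ
    obtain ⟨M, hs, hM, hnd⟩ := exists_matrix_of_bicharacter hω b hχ
    have hmap := map_toPrime_graphSpan hω b hM hΓ
    have hMy : (blockMy p Γ).IsSymm := by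
      ext i j
      simp [blockMy, hΓ.symm.apply]
    have hC : (kron (blockMy p Γ) M).IsSymm := kron_isSymm hMy hs
    have h0 : ∀ l, kron (blockMy p Γ) M l l = 0 := by
      intro l
      obtain ⟨⟨i, s⟩, rfl⟩ := finProdFinEquiv.surjective l
      rw [kron_apply]
      simp [blockMy, hΓ.loopless]
    refine ⟨graphState_tfae hω b hs hM hnd hΓ, ?_, M, hs, hM, ?_, ?_⟩
    · refine ErrorClosed.isStabilizerCode hω ((errorClosed_map_toPrime_iff b n).1 ?_) ?_
      · rw [hmap]
        exact graphCode_errorClosed hω hC h0 _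
      · intro h
        apply graphCode_ne_bot hω (kron (blockMy p Γ) M)
          (LinearMap.ker (kron (blockB p Γ) M).mulVecLin)
        rw [← hmap, h, Submodule.map_bot]
    · ext g
      rw [hmap, mem_stabilizerOf_graphCode hω hC h0]
      refine exists_congr fun a => and_congr_right fun _ => ?_
      -- The statement multiplies the row vector `a` by the output block, while the graph code uses
      -- a column; symmetry identifies the two.
      rw [← Matrix.vecMul_transpose, hC.eq]
      rfl
    · rw [hmap]
      exact mem_graphCode_iff_stabilizerOf hω hC h0 _
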